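/- Let $0<p<\infty$ and let $U\subseteq\mathbb{C}$ be a domain (a non-empty connected open set). For $a\in U$ let $\tau_U$ be the first exit time from $U$ of a planar Brownian motion started at $a$, write $E_a$ for the corresponding expectation, and assume that $E_a[\tau_U^p]<\infty$ for every $a\in U$. A $p$-th center of $U$ is a point $a\in U$ at which the function $a\mapsto E_a[\tau_U^p]$ attains its maximum over $U$. Let $\Delta\subset\mathbb{C}$ be a line and let $\sigma_\Delta$ denote the reflection across $\Delta$. Suppose that $\Delta$ is a symmetry axis of $U$, that is, $\sigma_\Delta(U)=U$, and that $U$ is $\Delta$-convex, that is, $tz+(1-t)\sigma_\Delta(z)\in U$ for all $z\in U$ and $t\in[0,1]$. Suppose further that $U$ is not an infinite strip (the open region between two parallel lines) whose boundary lines are perpendicular to $\Delta$. Then every $p$-th center of $U$ lies on $\Delta$. -/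

import Mathlib

open MeasureTheory ProbabilityTheory
open scoped NNReal ENNReal

noncomputable section

/-- `B` is a standard planar Brownian motion (started at the origin) under `P`: its real and
imaginary parts are independent standard one-dimensional Brownian motions. -/
structure IsPlanarBrownian {Ω : Type*} [MeasurableSpace Ω] (B : ℝ≥0 → Ω → ℂ) (P : Measure Ω) :
    Prop where
  re : IsBrownianReal (fun t ω ↦ (B t ω).re) P
  im : IsBrownianReal (fun t ω ↦ (B t ω).im) P
  indep : IndepFun (fun ω (t : ℝ≥0) ↦ (B t ω).re) (fun ω (t : ℝ≥0) ↦ (B t ω).im) P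

/-- The first exit time of the process `Z` from `U`, with value `∞` if `Z` never leaves `U`. -/
def exitTime {Ω : Type*} (U : Set ℂ) (Z : ℝ≥0 → Ω → ℂ) (ω : Ω) : ℝ≥0∞ :=
  ⨅ (t : ℝ≥0) (_ : Z t ω ∉ U), (t : ℝ≥0∞)

/-- The moment `E_a[τ_U ^ p]`, where `τ_U` is the exit time from `U` of the Brownian motion
`a + B` started at `a`. -/
def exitMoment {Ω : Type*} [MeasurableSpace Ω] (B : ℝ≥0 → Ω → ℂ) (P : Measure Ω)
    (U : Set ℂ) (p : ℝ) (a : ℂ) : ℝ≥0∞ :=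
  ∫⁻ ω, exitTime U (fun t ω ↦ a + B t ω) ω ^ p ∂P

/-- `a` is a `p`-th center of `U`: a point of `U` at which `E_a[τ_U ^ p]` is maximal. -/
def IsPthCenter {Ω : Type*} [MeasurableSpace Ω] (B : ℝ≥0 → Ω → ℂ) (P : Measure Ω)
    (U : Set ℂ) (p : ℝ) (a : ℂ) : Prop :=
  a ∈ U ∧ IsMaxOn (exitMoment B P U p) U a

/-- The line `Δ` is a symmetry axis of `U`. -/
def IsSymmetryAxis (Δ : AffineSubspace ℝ ℂ) [Nonempty Δ] (U : Set ℂ) : Prop :=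
  Module.finrank ℝ Δ.direction = 1 ∧ EuclideanGeometry.reflection Δ '' U = U

/-- `U` is `Δ`-convex: the segment joining any point of `U` to its mirror image in `Δ` stays
inside `U`. -/
def IsDeltaConvex (Δ : AffineSubspace ℝ ℂ) [Nonempty Δ] (U : Set ℂ) : Prop :=
  ∀ z ∈ U, ∀ t ∈ Set.Icc (0 : ℝ) 1,
    (t : ℂ) * z + (1 - (t : ℂ)) * EuclideanGeometry.reflection Δ z ∈ U

/-- `U` is an infinite strip (the open region between two parallel lines) whose boundary lines are
perpendicular to `Δ`, that is, whose normal vector `v` is a direction vector of `Δ`. -/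
def IsPerpendicularStrip (Δ : AffineSubspace ℝ ℂ) (U : Set ℂ) : Prop :=
  ∃ v ∈ Δ.direction, v ≠ 0 ∧
    ∃ c d : ℝ, c < d ∧ U = {z : ℂ | c < inner ℝ v z ∧ inner ℝ v z < d}

end

/-! Place Δ on the real axis. By Δ-convexity the nonempty vertical slices of `U` are intervals
symmetric about the axis. Suppose a center `a` lies strictly above it, and let σ be the reflection
in a horizontal line of height `s` with `0 < s < Im a`. The part of `U` above this line reflects
into `U`. Heuristically, couple the motion from `a` with its mirror image from `σ a` until they meet
on the line: the mirror image survives at least as long. Quantitatively, `P_{σa}(τ > t) - P_a(τ >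
t)` is at least the probability that the motion from `a` stays up to time `t` in the mirror image of
`U` above the line, yet leaves `U`.

If some slice is bounded, this probability is positive for a suitable `s` and some `t`: the upper
mirror image is connected and reaches beyond the top of that slice. Integrating the tails gives a
strictly larger moment at `σ a`, a contradiction. Hence every nonempty slice is a full line and `U =
I × ℝ` for an open interval `I`. If `I` were unbounded, a horizontal translation would carry
`closure U` into `U` and strictly increase the moment. So `I` is bounded, and `U` is the excluded
strip.

The coupling, and with it the strong Markov property, is replaced by Gaussian walks at dyadic times.
Pairing each point with its mirror image gives an inequality by induction on the number of steps
(`walkProb_polarised_le`); its loss factor tends to 1 as the grid is refined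
(`measure_stay_polarised_le`). The equality case is `measure_stay_upperRefl_diff_eq_zero`,
positivity is `exists_measure_cross_pos`, and `eq_vertical_strip_of_isMaxOn` assembles the argument.
-/

/-! ### The planar Gaussian law -/

/-- The density of the centred isotropic Gaussian law on `ℂ` with variance `t` per coordinate. -/
noncomputable def heatKernel (t : ℝ≥0) (z : ℂ) : ℝ≥0∞ :=
  ENNReal.ofReal ((2 * Real.pi * t)⁻¹ * Real.exp (-‖z‖ ^ 2 / (2 * t)))

theorem measurable_heatKernel (t : ℝ≥0) : Measurable (heatKernel t) := by
  unfold heatKernel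
  fun_prop

/-- The law at time `t > 0` of planar Brownian motion started at the origin. -/
noncomputable def heatMeasure (t : ℝ≥0) : Measure ℂ := volume.withDensity (heatKernel t)

theorem heatMeasure_eq_map {t : ℝ≥0} (ht : t ≠ 0) :
    heatMeasure t = ((gaussianReal 0 t).prod (gaussianReal 0 t)).map
      Complex.measurableEquivRealProd.symm := by
  rw [gaussianReal_of_var_ne_zero _ ht,
    prod_withDensity (measurable_gaussianPDF 0 t) (measurable_gaussianPDF 0 t)]
  ext s hs
  rw [Measure.map_apply Complex.measurableEquivRealProd.symm.measurable hs,
    withDensity_apply _ (Complex.measurableEquivRealProd.symm.measurable hs), heatMeasure,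
    withDensity_apply _ hs,
    ← Complex.volume_preserving_equiv_real_prod.symm.setLIntegral_comp_preimage hs
      (measurable_heatKernel t)]
  refine lintegral_congr fun x ↦ ?_
  have ht' : (0 : ℝ) < t := lt_of_le_of_ne t.2 (fun h ↦ ht (NNReal.coe_eq_zero.1 h.symm))
  have hs2 : (√(2 * Real.pi * t))⁻¹ * (√(2 * Real.pi * t))⁻¹ = (2 * Real.pi * t)⁻¹ := by
    rw [← mul_inv, Real.mul_self_sqrt (by positivity)]
  rw [gaussianPDF, gaussianPDF, ← ENNReal.ofReal_mul (gaussianPDFReal_nonneg 0 t _), heatKernel]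
  congr 1
  simp only [gaussianPDFReal, sub_zero]
  rw [mul_mul_mul_comm, hs2, ← Real.exp_add, Complex.sq_norm, Complex.normSq_apply]
  simp only [Complex.measurableEquivRealProd_symm_apply]
  congr 2
  ring

theorem isProbabilityMeasure_heatMeasure {t : ℝ≥0} (ht : t ≠ 0) :
    IsProbabilityMeasure (heatMeasure t) := by
  rw [heatMeasure_eq_map ht]
  exact Measure.isProbabilityMeasure_map (MeasurableEquiv.measurable _).aemeasurable

theorem lintegral_add_heatMeasure {t : ℝ≥0} {f : ℂ → ℝ≥0∞} (hf : Measurable f) (z : ℂ) :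
    ∫⁻ w, f (z + w) ∂(heatMeasure t) = ∫⁻ w, f w * heatKernel t (z - w) := by
  have h := lintegral_withDensity_eq_lintegral_mul (volume : Measure ℂ) (measurable_heatKernel t)
    (hf.comp (measurable_const_add z))
  simp only [Function.comp_def] at h
  rw [heatMeasure, h, ← lintegral_add_left_eq_self (fun w ↦ f w * heatKernel t (z - w)) z]
  refine lintegral_congr fun w ↦ ?_
  simp [heatKernel, mul_comm]

/-- A planar Brownian motion started at the origin all of whose paths are continuous. -/
structure IsContPlanarBrownian {Ω : Type*} [MeasurableSpace Ω] (B : ℝ≥0 → Ω → ℂ)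
    (P : Measure Ω) : Prop where
  meas : ∀ t, Measurable (B t)
  cont : ∀ ω, Continuous (B · ω)
  zero : ∀ ω, B 0 ω = 0
  law : ∀ s t, t ≠ 0 → P.map (fun ω ↦ B (s + t) ω - B s ω) = heatMeasure t
  indep : ∀ s, IndepFun (fun ω (t : ℝ≥0) ↦ B (min t s) ω)
    (fun ω (t : ℝ≥0) ↦ B (s + t) ω - B s ω) P

/-! ### Independence of pairs -/

section Independence

variable {Ω : Type*} [MeasurableSpace Ω] {P : Measure Ω}

/-- Factorisation is checked on rectangles, a generating π-system. It serves to combine past and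
future of the real part with past and future of the imaginary part. -/
theorem IndepFun.prodMk_comp_comp {α β α₁ α₂ β₁ β₂ : Type*} [MeasurableSpace α]
    [MeasurableSpace β] [MeasurableSpace α₁] [MeasurableSpace α₂] [MeasurableSpace β₁]
    [MeasurableSpace β₂] {X : Ω → α} {Y : Ω → β} (hX : Measurable X) (hY : Measurable Y)
    (hXY : IndepFun X Y P) [IsProbabilityMeasure P]
    {f₁ : α → α₁} {f₂ : α → α₂} {g₁ : β → β₁} {g₂ : β → β₂}
    (hf₁ : Measurable f₁) (hf₂ : Measurable f₂) (hg₁ : Measurable g₁) (hg₂ : Measurable g₂)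
    (hf : IndepFun (f₁ ∘ X) (f₂ ∘ X) P) (hg : IndepFun (g₁ ∘ Y) (g₂ ∘ Y) P) :
    IndepFun (fun ω ↦ (f₁ (X ω), g₁ (Y ω))) (fun ω ↦ (f₂ (X ω), g₂ (Y ω))) P := by
  have hm₁ : Measurable (fun ω ↦ (f₁ (X ω), g₁ (Y ω))) :=
    (hf₁.comp hX).prodMk (hg₁.comp hY)
  have hm₂ : Measurable (fun ω ↦ (f₂ (X ω), g₂ (Y ω))) :=
    (hf₂.comp hX).prodMk (hg₂.comp hY)
  refine IndepSets.indep hm₁.comap_le hm₂.comap_le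
    ((isPiSystem_prod (α := α₁) (β := β₁)).comap fun ω ↦ (f₁ (X ω), g₁ (Y ω)))
    ((isPiSystem_prod (α := α₂) (β := β₂)).comap fun ω ↦ (f₂ (X ω), g₂ (Y ω))) ?_ ?_ ?_
  · rw [← generateFrom_prod, MeasurableSpace.comap_generateFrom]
    rfl
  · rw [← generateFrom_prod, MeasurableSpace.comap_generateFrom]
    rfl
  rw [IndepSets_iff]
  rintro _ _ ⟨_, ⟨A, hA, A', hA', rfl⟩, rfl⟩ ⟨_, ⟨C, hC, C', hC', rfl⟩, rfl⟩
  replace hA : MeasurableSet A := hA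
  replace hA' : MeasurableSet A' := hA'
  replace hC : MeasurableSet C := hC
  replace hC' : MeasurableSet C' := hC'
  have e1 : (fun ω ↦ (f₁ (X ω), g₁ (Y ω))) ⁻¹' A ×ˢ A' = X ⁻¹' (f₁ ⁻¹' A) ∩ Y ⁻¹' (g₁ ⁻¹' A') :=
    rfl
  have e2 : (fun ω ↦ (f₂ (X ω), g₂ (Y ω))) ⁻¹' C ×ˢ C' = X ⁻¹' (f₂ ⁻¹' C) ∩ Y ⁻¹' (g₂ ⁻¹' C') :=
    rfl
  have e3 : (X ⁻¹' (f₁ ⁻¹' A) ∩ Y ⁻¹' (g₁ ⁻¹' A')) ∩ (X ⁻¹' (f₂ ⁻¹' C) ∩ Y ⁻¹' (g₂ ⁻¹' C')) =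
      X ⁻¹' (f₁ ⁻¹' A ∩ f₂ ⁻¹' C) ∩ Y ⁻¹' (g₁ ⁻¹' A' ∩ g₂ ⁻¹' C') := by
    ext; simp; tauto
  rw [e1, e2, e3, hXY.measure_inter_preimage_eq_mul _ _ ((hf₁ hA).inter (hf₂ hC))
      ((hg₁ hA').inter (hg₂ hC')),
    hXY.measure_inter_preimage_eq_mul _ _ (hf₁ hA) (hg₁ hA'),
    hXY.measure_inter_preimage_eq_mul _ _ (hf₂ hC) (hg₂ hC'),
    Set.preimage_inter, Set.preimage_inter]
  have h1 := hf.measure_inter_preimage_eq_mul _ _ hA hC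
  have h2 := hg.measure_inter_preimage_eq_mul _ _ hA' hC'
  simp only [Set.preimage_comp] at h1 h2
  rw [h1, h2]
  ring

end Independence

/-! ### A version with everywhere continuous, measurable paths -/

namespace IsPlanarBrownian

variable {Ω : Type*} [MeasurableSpace Ω] {P : Measure Ω} {B : ℝ≥0 → Ω → ℂ}

theorem isProbabilityMeasure (hB : IsPlanarBrownian B P) : IsProbabilityMeasure P :=
  hB.re.isGaussianProcess.isProbabilityMeasure

theorem aemeasurable (hB : IsPlanarBrownian B P) (t : ℝ≥0) : AEMeasurable (B t) P := by
  have h1 := hB.re.aemeasurable t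
  have h2 := hB.im.aemeasurable t
  exact Complex.measurableEquivRealProd.symm.measurable.comp_aemeasurable (h1.prodMk h2)

/-- The paths are set to 0 on a measurable null set containing all bad paths. Off that set they
agree with measurable versions at countably many dense times, and continuity makes every other time
a limit of those. -/
theorem exists_ae_eq (hB : IsPlanarBrownian B P) :
    ∃ B' : ℝ≥0 → Ω → ℂ, (∀ t, Measurable (B' t)) ∧ (∀ ω, Continuous (B' · ω)) ∧
      (∀ ω, B' 0 ω = 0) ∧ ∀ᵐ ω ∂P, ∀ t, B t ω = B' t ω := by
  have hm := hB.aemeasurable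
  have hae : ∀ᵐ ω ∂P, Continuous (B · ω) ∧ B 0 ω = 0 ∧
      ∀ n, B (TopologicalSpace.denseSeq ℝ≥0 n) ω = (hm (TopologicalSpace.denseSeq ℝ≥0 n)).mk _ ω := by
    have h3 : ∀ᵐ ω ∂P, ∀ n, B (TopologicalSpace.denseSeq ℝ≥0 n) ω =
        (hm (TopologicalSpace.denseSeq ℝ≥0 n)).mk _ ω := ae_all_iff.2 fun n ↦ (hm _).ae_eq_mk
    filter_upwards [hB.re.cont, hB.im.cont, hB.re.eval_zero_ae_eq_zero,
      hB.im.eval_zero_ae_eq_zero, h3] with ω h1 h2 h4 h5 h6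
    refine ⟨?_, Complex.ext h4 h5, h6⟩
    have : Continuous fun t ↦ Complex.equivRealProdCLM.symm ((B t ω).re, (B t ω).im) :=
      Complex.equivRealProdCLM.symm.continuous.comp (h1.prodMk h2)
    exact this.congr fun t ↦ Complex.ext rfl rfl
  obtain ⟨N, hN, hNm, hN0⟩ := exists_measurable_superset_of_null (ae_iff.1 hae)
  have hgood : ∀ ω ∉ N, _ := fun ω hω ↦ not_not.1 fun h ↦ hω (hN h)
  classical
  refine ⟨fun t ω ↦ if ω ∈ N then 0 else B t ω, fun t ↦ ?_, fun ω ↦ ?_, fun ω ↦ ?_, ?_⟩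
  · obtain ⟨x, hx, hxt⟩ := mem_closure_iff_seq_limit.1
      ((TopologicalSpace.denseRange_denseSeq ℝ≥0) t)
    choose k hk using hx
    refine measurable_of_tendsto_metrizable
      (f := fun n ω ↦ if ω ∈ N then 0 else (hm (TopologicalSpace.denseSeq ℝ≥0 (k n))).mk _ ω)
      (fun n ↦ Measurable.ite hNm measurable_const (hm _).measurable_mk) ?_
    rw [tendsto_pi_nhds]
    intro ω
    by_cases hω : ω ∈ N
    · simp [hω]
    · simp only [hω, if_false, ← (hgood ω hω).2.2]
      exact ((hgood ω hω).1.tendsto t).comp (by simpa [hk] using hxt)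
  · by_cases hω : ω ∈ N
    · simpa [hω] using continuous_const
    · simpa [hω] using (hgood ω hω).1
  · by_cases hω : ω ∈ N
    · simp [hω]
    · simpa [hω] using (hgood ω hω).2.1
  · filter_upwards [measure_eq_zero_iff_ae_notMem.1 hN0] with ω hω t
    simp [hω]

theorem congr_ae {B' : ℝ≥0 → Ω → ℂ} (hB : IsPlanarBrownian B P)
    (hc : ∀ ω, Continuous (B' · ω)) (h : ∀ᵐ ω ∂P, ∀ t, B t ω = B' t ω) :
    IsPlanarBrownian B' P where
  re := ⟨hB.re.toIsPreBrownianReal.congr fun t ↦ by filter_upwards [h] with ω hω; rw [hω],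
    .of_forall fun ω ↦ Complex.continuous_re.comp (hc ω)⟩
  im := ⟨hB.im.toIsPreBrownianReal.congr fun t ↦ by filter_upwards [h] with ω hω; rw [hω],
    .of_forall fun ω ↦ Complex.continuous_im.comp (hc ω)⟩
  indep := hB.indep.congr
    (by filter_upwards [h] with ω hω; simp only [hω])
    (by filter_upwards [h] with ω hω; simp only [hω])

theorem isContPlanarBrownian (hB : IsPlanarBrownian B P) (hm : ∀ t, Measurable (B t))
    (hc : ∀ ω, Continuous (B · ω)) (h0 : ∀ ω, B 0 ω = 0) : IsContPlanarBrownian B P where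
  meas := hm
  cont := hc
  zero := h0
  law s t ht := by
    have := hB.isProbabilityMeasure
    have h1 := (hB.re.shift s).hasLaw_eval t
    have h2 := (hB.im.shift s).hasLaw_eval t
    have h3 : IndepFun (fun ω ↦ (B (s + t) ω).re - (B s ω).re)
        (fun ω ↦ (B (s + t) ω).im - (B s ω).im) P :=
      hB.indep.comp (φ := fun (x : ℝ≥0 → ℝ) ↦ x (s + t) - x s)
        (ψ := fun (x : ℝ≥0 → ℝ) ↦ x (s + t) - x s)
        (by fun_prop) (by fun_prop)
    rw [indepFun_iff_map_prod_eq_prod_map_map h1.aemeasurable h2.aemeasurable, h1.map_eq,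
      h2.map_eq] at h3
    rw [heatMeasure_eq_map ht, ← h3, AEMeasurable.map_map_of_aemeasurable
      (MeasurableEquiv.measurable _).aemeasurable (h1.aemeasurable.prodMk h2.aemeasurable)]
    congr 1
  indep s := by
    have := hB.isProbabilityMeasure
    have key : ∀ X : ℝ≥0 → Ω → ℝ, IsBrownianReal X P →
        IndepFun ((fun (x : ℝ≥0 → ℝ) t ↦ x (min t s)) ∘ fun ω t ↦ X t ω)
          ((fun (x : ℝ≥0 → ℝ) t ↦ x (s + t) - x s) ∘ fun ω t ↦ X t ω) P := fun X hX ↦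
      (hX.indepFun_shift s).symm.comp
        (φ := fun (x : Set.Iic s → ℝ) (t : ℝ≥0) ↦ x ⟨min t s, min_le_right t s⟩) (ψ := id)
        (measurable_pi_lambda _ fun t ↦ measurable_pi_apply _) measurable_id
    have := IndepFun.prodMk_comp_comp (P := P)
      (X := fun ω (t : ℝ≥0) ↦ (B t ω).re) (Y := fun ω (t : ℝ≥0) ↦ (B t ω).im)
      (measurable_pi_lambda _ fun t ↦ Complex.measurable_re.comp (hm t))
      (measurable_pi_lambda _ fun t ↦ Complex.measurable_im.comp (hm t)) hB.indep
      (by fun_prop) (by fun_prop) (by fun_prop) (by fun_prop) (key _ hB.re) (key _ hB.im)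
    have hφ : Measurable fun (x : (ℝ≥0 → ℝ) × (ℝ≥0 → ℝ)) (t : ℝ≥0) ↦
        Complex.measurableEquivRealProd.symm (x.1 t, x.2 t) :=
      measurable_pi_lambda _ fun t ↦ Complex.measurableEquivRealProd.symm.measurable.comp
        (((measurable_pi_apply t).comp measurable_fst).prodMk
          ((measurable_pi_apply t).comp measurable_snd))
    have h := this.comp hφ hφ
    refine h.congr (.of_forall fun ω ↦ ?_) (.of_forall fun ω ↦ ?_) <;>
    · ext t
      refine Complex.ext ?_ ?_ <;> simp

end IsPlanarBrownian

/-! ### Time shifts and rotations of Brownian motion -/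

namespace IsContPlanarBrownian

variable {Ω : Type*} [MeasurableSpace Ω] {P : Measure Ω} {B : ℝ≥0 → Ω → ℂ}

theorem law_eval (hB : IsContPlanarBrownian B P) {t : ℝ≥0} (ht : t ≠ 0) :
    P.map (B t) = heatMeasure t := by
  simpa [hB.zero] using hB.law 0 t ht

theorem isProbabilityMeasure (hB : IsContPlanarBrownian B P) : IsProbabilityMeasure P := by
  have := isProbabilityMeasure_heatMeasure one_ne_zero
  rw [← hB.law_eval one_ne_zero] at this
  exact Measure.isProbabilityMeasure_of_map (B 1)

theorem shift (hB : IsContPlanarBrownian B P) (s : ℝ≥0) :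
    IsContPlanarBrownian (fun t ω ↦ B (s + t) ω - B s ω) P where
  meas t := (hB.meas _).sub (hB.meas _)
  cont ω := by
    have := hB.cont ω
    fun_prop
  zero ω := by simp
  law u t ht := by
    rw [← hB.law (s + u) t ht]
    congr 1
    ext ω
    rw [add_assoc]
    ring
  indep u := by
    have h := (hB.indep (s + u)).comp
      (φ := fun (x : ℝ≥0 → ℂ) t ↦ x (s + min t u) - x s) (ψ := id) (by fun_prop) measurable_id
    refine h.congr (.of_forall fun ω ↦ ?_) (.of_forall fun ω ↦ ?_)
    · ext t
      have : s + min t u ≤ s + u := by gcongr; exact min_le_right _ _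
      simp [this]
    · ext t
      simp [add_assoc]

theorem heatKernel_mul {u : ℂ} (hu : ‖u‖ = 1) (t : ℝ≥0) (z : ℂ) :
    heatKernel t (u * z) = heatKernel t z := by
  simp [heatKernel, hu]

theorem map_mul_heatMeasure {u : ℂ} (hu : ‖u‖ = 1) (t : ℝ≥0) :
    (heatMeasure t).map (u * ·) = heatMeasure t := by
  have hmp : MeasurePreserving (u * ·) (volume : Measure ℂ) volume :=
    (rotation ⟨u, by simpa [Submonoid.unitSphere] using hu⟩).measurePreserving
  ext s hs
  rw [Measure.map_apply (measurable_const_mul u) hs, heatMeasure,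
    withDensity_apply _ (measurable_const_mul u hs), withDensity_apply _ hs,
    ← hmp.setLIntegral_comp_preimage hs (measurable_heatKernel t)]
  simp only [heatKernel_mul hu]

theorem const_mul (hB : IsContPlanarBrownian B P) {u : ℂ} (hu : ‖u‖ = 1) :
    IsContPlanarBrownian (fun t ω ↦ u * B t ω) P where
  meas t := (hB.meas t).const_mul u
  cont ω := (hB.cont ω).const_mul u
  zero ω := by simp [hB.zero]
  law s t ht := by
    have hm : Measurable fun ω ↦ B (s + t) ω - B s ω := (hB.meas (s + t)).sub (hB.meas s)
    rw [← map_mul_heatMeasure hu, ← hB.law s t ht, Measure.map_map (measurable_const_mul u) hm]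
    simp only [Function.comp_def, mul_sub]
  indep s := by
    have h := (hB.indep s).comp (φ := fun (x : ℝ≥0 → ℂ) t ↦ u * x t)
      (ψ := fun (x : ℝ≥0 → ℂ) t ↦ u * x t) (by fun_prop) (by fun_prop)
    simpa only [Function.comp_def, mul_sub] using h

end IsContPlanarBrownian

open Filter Topology

/-! ### Continuous paths staying in a set -/

/-- The points at distance at least `1 / (k + 1)` from the complement of `U`. -/
def innerPart (U : Set ℂ) (k : ℕ) : Set ℂ := {z | ((k : ℝ≥0∞) + 1)⁻¹ ≤ Metric.infEDist z Uᶜ}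

theorem isClosed_innerPart (U : Set ℂ) (k : ℕ) : IsClosed (innerPart U k) :=
  isClosed_le continuous_const Metric.continuous_infEDist

theorem innerPart_subset (U : Set ℂ) (k : ℕ) : innerPart U k ⊆ U := by
  intro z hz
  by_contra h
  have : Metric.infEDist z Uᶜ = 0 := Metric.infEDist_zero_of_mem h
  rw [innerPart, Set.mem_ofPred_eq, this] at hz
  simp at hz

theorem innerPart_mono (U : Set ℂ) : Monotone (innerPart U) := by
  intro k l hkl z hz
  rw [innerPart, Set.mem_ofPred_eq] at hz ⊢
  refine le_trans ?_ hz
  gcongr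

theorem exists_subset_innerPart {U K : Set ℂ} (hU : IsOpen U) (hK : IsCompact K) (h : K ⊆ U) :
    ∃ k, K ⊆ innerPart U k := by
  rcases K.eq_empty_or_nonempty with rfl | hne
  · exact ⟨0, Set.empty_subset _⟩
  obtain ⟨z, hz, hmin⟩ := hK.exists_isMinOn hne
    (Metric.continuous_infEDist (s := Uᶜ)).continuousOn
  have hpos : Metric.infEDist z Uᶜ ≠ 0 := by
    intro h0
    have := Metric.mem_closure_iff_infEDist_zero.2 h0
    rw [hU.isClosed_compl.closure_eq] at this
    exact this (h hz)
  obtain ⟨k, hk⟩ := ENNReal.exists_inv_nat_lt hpos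
  refine ⟨k, fun w hw ↦ ?_⟩
  rw [innerPart, Set.mem_ofPred_eq]
  refine le_trans (le_trans ?_ hk.le) (hmin hw)
  gcongr
  exact le_self_add

/-- Paths in `K` up to time `t`, as seen on a countable dense set of times. -/
def denseStay (K : Set ℂ) (t : ℝ≥0) : Set (ℝ≥0 → ℂ) :=
  {x | ∀ n, x (min (TopologicalSpace.denseSeq ℝ≥0 n) t) ∈ K}

theorem measurableSet_denseStay {K : Set ℂ} (hK : MeasurableSet K) (t : ℝ≥0) :
    MeasurableSet (denseStay K t) := by
  simp only [denseStay, Set.ofPred_forall]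
  exact MeasurableSet.iInter fun n ↦ measurable_pi_apply _ hK

theorem mem_denseStay {K : Set ℂ} (hK : IsClosed K) {t : ℝ≥0} {x : ℝ≥0 → ℂ}
    (hx : Continuous x) : x ∈ denseStay K t ↔ ∀ s ≤ t, x s ∈ K := by
  refine ⟨fun h s hs ↦ ?_, fun h n ↦ h _ (min_le_right _ _)⟩
  have hc : IsClosed {s : ℝ≥0 | x (min s t) ∈ K} := hK.preimage (by fun_prop)
  have := hc.closure_subset_iff.2 (Set.range_subset_iff.2 h)
  rw [(TopologicalSpace.denseRange_denseSeq ℝ≥0).closure_range] at this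
  simpa [hs] using this (Set.mem_univ s)

/-- The image of `[0, t]` is compact, so a path inside `U` keeps a positive distance from the
complement. This makes staying in an open set measurable and reduces it to closed sets. -/
theorem exists_mem_denseStay {U : Set ℂ} (hU : IsOpen U) {t : ℝ≥0} {x : ℝ≥0 → ℂ}
    (hx : Continuous x) : (∃ k, x ∈ denseStay (innerPart U k) t) ↔ ∀ s ≤ t, x s ∈ U := by
  simp only [mem_denseStay (isClosed_innerPart U _) hx]
  refine ⟨fun ⟨k, hk⟩ s hs ↦ innerPart_subset U k (hk s hs), fun h ↦ ?_⟩
  obtain ⟨k, hk⟩ := exists_subset_innerPart hU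
    ((isCompact_Icc (a := (0 : ℝ≥0)) (b := t)).image hx) (Set.image_subset_iff.2 fun s hs ↦ h s hs.2)
  exact ⟨k, fun s hs ↦ hk (Set.mem_image_of_mem _ ⟨zero_le, hs⟩)⟩

/-- Paths staying in `U` up to time `t`, as a measurable set of paths. -/
def openStay (U : Set ℂ) (t : ℝ≥0) : Set (ℝ≥0 → ℂ) := ⋃ k, denseStay (innerPart U k) t

theorem measurableSet_openStay (U : Set ℂ) (t : ℝ≥0) : MeasurableSet (openStay U t) :=
  MeasurableSet.iUnion fun k ↦ measurableSet_denseStay (isClosed_innerPart U k).measurableSet t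

theorem mem_openStay {U : Set ℂ} (hU : IsOpen U) {t : ℝ≥0} {x : ℝ≥0 → ℂ}
    (hx : Continuous x) : x ∈ openStay U t ↔ ∀ s ≤ t, x s ∈ U := by
  rw [openStay, Set.mem_iUnion, exists_mem_denseStay hU hx]

/-! ### Exit times of continuous paths -/

/-- Time `t` itself is included: `U` is open, so a path in `U` at time `t` remains there a little
longer. -/
theorem lt_exitTime_iff {Ω : Type*} {U : Set ℂ} (hU : IsOpen U) {Z : ℝ≥0 → Ω → ℂ} {ω : Ω}
    (hZ : Continuous (Z · ω)) (t : ℝ≥0) : (t : ℝ≥0∞) < exitTime U Z ω ↔ ∀ s ≤ t, Z s ω ∈ U := by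
  constructor
  · intro h s hs
    by_contra hsU
    have : exitTime U Z ω ≤ s := iInf₂_le s hsU
    exact absurd (h.trans_le this) (by simpa using hs)
  · intro h
    have hev : ∀ᶠ r in 𝓝 t, Z r ω ∈ U := hZ.tendsto t (hU.mem_nhds (h t le_rfl))
    have : ∃ r > t, ∀ s < r, Z s ω ∈ U := by
      obtain ⟨l, hl, hr⟩ := exists_Ico_subset_of_mem_nhds hev ⟨t + 1, lt_add_one t⟩
      refine ⟨l, hl, fun s hs ↦ ?_⟩
      rcases le_or_gt s t with h1 | h1
      · exact h s h1
      · exact hr ⟨h1.le, hs⟩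
    obtain ⟨r, hr, hs⟩ := this
    refine lt_of_lt_of_le (ENNReal.coe_lt_coe.2 hr) (le_iInf₂ fun s hsU ↦ ?_)
    by_contra hlt
    exact hsU (hs s (by simpa using hlt))

namespace IsContPlanarBrownian

variable {Ω : Type*} [MeasurableSpace Ω] {P : Measure Ω} {B : ℝ≥0 → Ω → ℂ}

theorem continuous_add (hB : IsContPlanarBrownian B P) (z : ℂ) (ω : Ω) :
    Continuous fun t ↦ z + B t ω := (hB.cont ω).const_add z

theorem measurable_add (hB : IsContPlanarBrownian B P) (z : ℂ) :
    Measurable fun ω (t : ℝ≥0) ↦ z + B t ω :=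
  measurable_pi_lambda _ fun t ↦ (hB.meas t).const_add z

theorem measurableSet_stay_of_isOpen (hB : IsContPlanarBrownian B P) {U : Set ℂ} (hU : IsOpen U)
    (z : ℂ) (t : ℝ≥0) : MeasurableSet {ω | ∀ s ≤ t, z + B s ω ∈ U} := by
  convert hB.measurable_add z (measurableSet_openStay U t) using 1
  ext ω
  exact (mem_openStay hU (hB.continuous_add z ω)).symm

theorem measurable_exitTime (hB : IsContPlanarBrownian B P) {U : Set ℂ} (hU : IsOpen U) (z : ℂ) :
    Measurable (exitTime U fun t ω ↦ z + B t ω) := by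
  refine measurable_of_Ioi fun c ↦ ?_
  induction c with
  | top => simp
  | coe t =>
    convert hB.measurableSet_stay_of_isOpen hU z t using 1
    ext ω
    exact lt_exitTime_iff hU (hB.continuous_add z ω) t

theorem tendsto_measure_stay_innerPart (hB : IsContPlanarBrownian B P) {U : Set ℂ}
    (hU : IsOpen U) (z : ℂ) (t : ℝ≥0) :
    Tendsto (fun k ↦ P {ω | ∀ s ≤ t, z + B s ω ∈ innerPart U k}) atTop
      (𝓝 (P {ω | ∀ s ≤ t, z + B s ω ∈ U})) := by
  have : {ω | ∀ s ≤ t, z + B s ω ∈ U} = ⋃ k, {ω | ∀ s ≤ t, z + B s ω ∈ innerPart U k} := by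
    ext ω
    simp only [Set.mem_ofPred_eq, Set.mem_iUnion]
    rw [← exists_mem_denseStay hU (hB.continuous_add z ω)]
    simp only [mem_denseStay (isClosed_innerPart U _) (hB.continuous_add z ω)]
  rw [this]
  exact tendsto_measure_iUnion_atTop fun k l hkl ω hω s hs ↦ innerPart_mono U hkl (hω s hs)

/-- The Markov property at a deterministic time. -/
theorem measure_markov (hB : IsContPlanarBrownian B P) (s : ℝ≥0) {S : Set (ℂ × (ℝ≥0 → ℂ))}
    (hS : MeasurableSet S) :
    P {ω | (B s ω, fun t ↦ B (s + t) ω - B s ω) ∈ S} =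
      ∫⁻ w, P {ω | (w, fun t ↦ B (s + t) ω - B s ω) ∈ S} ∂(P.map (B s)) := by
  have := hB.isProbabilityMeasure
  have hm : Measurable fun ω (t : ℝ≥0) ↦ B (s + t) ω - B s ω :=
    measurable_pi_lambda _ fun t ↦ (hB.meas _).sub (hB.meas _)
  have hi : IndepFun (B s) (fun ω (t : ℝ≥0) ↦ B (s + t) ω - B s ω) P := by
    simpa [Function.comp_def] using (hB.indep s).comp (φ := fun x : ℝ≥0 → ℂ ↦ x s) (ψ := id)
      (measurable_pi_apply s) measurable_id
  rw [indepFun_iff_map_prod_eq_prod_map_map (hB.meas s).aemeasurable hm.aemeasurable] at hi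
  have h1 : P {ω | (B s ω, fun t ↦ B (s + t) ω - B s ω) ∈ S} =
      P.map (fun ω ↦ (B s ω, fun t ↦ B (s + t) ω - B s ω)) S :=
    (Measure.map_apply ((hB.meas s).prodMk hm) hS).symm
  have := Measure.isProbabilityMeasure_map (μ := P) hm.aemeasurable
  rw [h1, hi, Measure.prod_apply hS]
  refine lintegral_congr fun w ↦ ?_
  rw [Measure.map_apply hm (measurable_prodMk_left hS)]
  rfl

end IsContPlanarBrownian

/-! ### Skeletons at equally spaced times -/

/-- The probability that a Gaussian random walk with steps of law `heatMeasure δ` started at `z`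
is in `A` at all times `0, …, n`. -/
noncomputable def walkProb (A : Set ℂ) (δ : ℝ≥0) : ℕ → ℂ → ℝ≥0∞
  | 0 => A.indicator 1
  | n + 1 => A.indicator fun z ↦ ∫⁻ w, walkProb A δ n w * heatKernel δ (z - w)

theorem measurable_walkProb {A : Set ℂ} (hA : MeasurableSet A) (δ : ℝ≥0) (n : ℕ) :
    Measurable (walkProb A δ n) := by
  induction n with
  | zero => exact measurable_const.indicator hA
  | succ n ih =>
    refine Measurable.indicator ?_ hA
    refine Measurable.lintegral_prod_right'
      (f := fun p : ℂ × ℂ ↦ walkProb A δ n p.2 * heatKernel δ (p.1 - p.2)) ?_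
    exact (ih.comp measurable_snd).mul
      ((measurable_heatKernel δ).comp (measurable_fst.sub measurable_snd))

/-- Induction by the Markov property at time `δ`. The motion is quantified after `n`, because the
induction hypothesis is applied to the shifted motion. -/
theorem IsContPlanarBrownian.measure_forall_mem_eq_walkProb {Ω : Type*} [MeasurableSpace Ω]
    {P : Measure Ω} {A : Set ℂ} (hA : MeasurableSet A) {δ : ℝ≥0} (hδ : δ ≠ 0) (n : ℕ) :
    ∀ {B : ℝ≥0 → Ω → ℂ}, IsContPlanarBrownian B P → ∀ z,
      P {ω | ∀ i ≤ n, z + B (i * δ) ω ∈ A} = walkProb A δ n z := by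
  induction n with
  | zero =>
    intro B hB z
    have := hB.isProbabilityMeasure
    by_cases hz : z ∈ A <;> simp [walkProb, hB.zero, hz]
  | succ n ih =>
    intro B hB z
    have hset : {ω | ∀ i ≤ n + 1, z + B (i * δ) ω ∈ A} =
        {ω | z ∈ A ∧ (B δ ω, fun t ↦ B (δ + t) ω - B δ ω) ∈
          {p : ℂ × (ℝ≥0 → ℂ) | ∀ i ≤ n, z + p.1 + p.2 (i * δ) ∈ A}} := by
      ext ω
      have he : ∀ i : ℕ, z + B δ ω + (B (δ + i * δ) ω - B δ ω) = z + B ((i + 1 : ℕ) * δ) ω := by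
        intro i
        rw [show ((i + 1 : ℕ) : ℝ≥0) * δ = δ + i * δ by push_cast; ring]
        ring
      simp only [Set.mem_ofPred_eq, he]
      constructor
      · intro h
        exact ⟨by simpa [hB.zero] using h 0 (Nat.zero_le _), fun i hi ↦ h (i + 1) (by omega)⟩
      · rintro ⟨h0, h⟩ i hi
        rcases i with _ | i
        · simpa [hB.zero] using h0
        · exact h i (by omega)
    have hS : MeasurableSet {p : ℂ × (ℝ≥0 → ℂ) | ∀ i ≤ n, z + p.1 + p.2 (i * δ) ∈ A} := by
      simp only [Set.ofPred_forall]
      refine MeasurableSet.iInter fun i ↦ MeasurableSet.iInter fun _ ↦ ?_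
      exact ((measurable_fst.const_add z).add ((measurable_pi_apply _).comp measurable_snd)) hA
    rw [hset, walkProb]
    by_cases hz : z ∈ A
    · rw [Set.indicator_of_mem hz, ← lintegral_add_heatMeasure (measurable_walkProb hA δ n),
        ← hB.law_eval hδ]
      simp only [hz, true_and]
      rw [hB.measure_markov δ hS]
      exact lintegral_congr fun w ↦ ih (hB.shift δ) (z + w)
    · simp [hz]

theorem exists_dyadic_mem {O : Set ℝ≥0} (hO : IsOpen O) {s t : ℝ≥0} (hs : s ≤ t) (ht : t ≠ 0)
    (hsO : s ∈ O) : ∃ m i : ℕ, i ≤ 2 ^ m ∧ (i : ℝ≥0) * (t / 2 ^ m) ∈ O := by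
  have hlim : Tendsto (fun m : ℕ ↦ ((⌊s / (t / 2 ^ m)⌋₊ : ℕ) : ℝ≥0) * (t / 2 ^ m)) atTop (𝓝 s) := by
    have h0 : Tendsto (fun m : ℕ ↦ s - t / 2 ^ m) atTop (𝓝 s) := by
      have h2 : Tendsto (fun m : ℕ ↦ t / 2 ^ m) atTop (𝓝 0) := by
        have := (NNReal.tendsto_pow_atTop_nhds_zero_of_lt_one (r := (2⁻¹ : ℝ≥0))
          (by rw [← NNReal.coe_lt_coe]; norm_num)).const_mul t
        simpa [div_eq_mul_inv] using this
      simpa using (tendsto_const_nhds (x := s)).sub h2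
    refine tendsto_of_tendsto_of_tendsto_of_le_of_le h0 tendsto_const_nhds (fun m ↦ ?_) fun m ↦ ?_
    · have hp : 0 < t / 2 ^ m := by positivity
      have := (Nat.lt_floor_add_one (s / (t / 2 ^ m))).le
      rw [div_le_iff₀ hp, add_mul, one_mul] at this
      exact tsub_le_iff_right.2 this
    · have hp : 0 < t / 2 ^ m := by positivity
      have := Nat.floor_le (zero_le (a := s / (t / 2 ^ m)))
      rwa [le_div_iff₀ hp] at this
  obtain ⟨m, hm⟩ := (hlim.eventually (hO.mem_nhds hsO)).exists
  refine ⟨m, _, ?_, hm⟩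
  have hp : 0 < t / 2 ^ m := by positivity
  refine Nat.floor_le_of_le ?_
  rw [div_le_iff₀ hp]
  push_cast
  rwa [mul_div_cancel₀ _ (by positivity)]

/-- For closed `A`, a continuous path stays in `A` on `[0, t]` iff it does so at all dyadic
fractions of `t`. The dyadic grids are nested, so the events decrease. -/
theorem IsContPlanarBrownian.tendsto_walkProb {Ω : Type*} [MeasurableSpace Ω]
    {P : Measure Ω} {B : ℝ≥0 → Ω → ℂ} (hB : IsContPlanarBrownian B P) {A : Set ℂ}
    (hA : IsClosed A) {t : ℝ≥0} (ht : t ≠ 0) (z : ℂ) :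
    Tendsto (fun m : ℕ ↦ walkProb A (t / 2 ^ m) (2 ^ m) z) atTop
      (𝓝 (P {ω | ∀ s ≤ t, z + B s ω ∈ A})) := by
  have := hB.isProbabilityMeasure
  have h1 : ∀ m : ℕ, walkProb A (t / 2 ^ m) (2 ^ m) z =
      P {ω | ∀ i : ℕ, i ≤ 2 ^ m → z + B (i * (t / 2 ^ m)) ω ∈ A} := fun m ↦
    (measure_forall_mem_eq_walkProb hA.measurableSet (by positivity) _ hB z).symm
  simp only [h1]
  have h2 : {ω | ∀ s ≤ t, z + B s ω ∈ A} =
      ⋂ m : ℕ, {ω | ∀ i : ℕ, i ≤ 2 ^ m → z + B (i * (t / 2 ^ m)) ω ∈ A} := by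
    ext ω
    simp only [Set.mem_ofPred_eq, Set.mem_iInter]
    constructor
    · intro h m i hi
      refine h _ ?_
      have : (i : ℝ≥0) ≤ 2 ^ m := by exact_mod_cast hi
      calc (i : ℝ≥0) * (t / 2 ^ m) ≤ 2 ^ m * (t / 2 ^ m) := by gcongr
        _ = t := mul_div_cancel₀ _ (by positivity)
    · intro h s hs
      by_contra hsA
      obtain ⟨m, i, hi, hiA⟩ := exists_dyadic_mem
        (hA.isOpen_compl.preimage (hB.continuous_add z ω)) hs ht hsA
      exact hiA (h m i hi)
  rw [h2]
  refine tendsto_measure_iInter_atTop (fun m ↦ ?_) ?_ ⟨0, measure_ne_top _ _⟩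
  · simp only [Set.ofPred_forall]
    refine (MeasurableSet.iInter fun i ↦ MeasurableSet.iInter fun _ ↦ ?_).nullMeasurableSet
    exact ((hB.meas _).const_add z) hA.measurableSet
  · refine antitone_nat_of_succ_le fun m ω h i hi ↦ ?_
    have := h (2 * i) (by rw [pow_succ]; omega)
    have he : ((2 * i : ℕ) : ℝ≥0) * (t / 2 ^ (m + 1)) = i * (t / 2 ^ m) := by
      push_cast
      rw [pow_succ]
      field_simp
    rwa [he] at this

/-! ### Reflection in a horizontal line -/

/-- The reflection across the horizontal line of height `s`. -/
def horizRefl (s : ℝ) (z : ℂ) : ℂ := ⟨z.re, 2 * s - z.im⟩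

@[simp] theorem horizRefl_re (s : ℝ) (z : ℂ) : (horizRefl s z).re = z.re := rfl

@[simp] theorem horizRefl_im (s : ℝ) (z : ℂ) : (horizRefl s z).im = 2 * s - z.im := rfl

@[simp] theorem horizRefl_horizRefl (s : ℝ) (z : ℂ) : horizRefl s (horizRefl s z) = z :=
  Complex.ext rfl (by simp)

theorem horizRefl_eq (s : ℝ) (z : ℂ) :
    horizRefl s z = Complex.conjLIE z + 2 * s * Complex.I := by
  refine Complex.ext ?_ ?_ <;> simp
  ring

theorem continuous_horizRefl (s : ℝ) : Continuous (horizRefl s) := by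
  have : horizRefl s = fun z ↦ Complex.conjLIE z + 2 * s * Complex.I := funext (horizRefl_eq s)
  rw [this]
  fun_prop

theorem measurePreserving_horizRefl (s : ℝ) : MeasurePreserving (horizRefl s) := by
  have : horizRefl s = (fun z ↦ z + 2 * s * Complex.I) ∘ Complex.conjLIE :=
    funext (horizRefl_eq s)
  rw [this]
  exact (measurePreserving_add_right volume _).comp Complex.conjLIE.measurePreserving

theorem lintegral_comp_horizRefl (s : ℝ) {f : ℂ → ℝ≥0∞} (hf : Measurable f) :
    ∫⁻ w, f (horizRefl s w) = ∫⁻ w, f w :=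
  (measurePreserving_horizRefl s).lintegral_comp hf

theorem heatKernel_eq_normSq (δ : ℝ≥0) (z : ℂ) : heatKernel δ z =
    ENNReal.ofReal ((2 * Real.pi * δ)⁻¹ * Real.exp (-(z.re ^ 2 + z.im ^ 2) / (2 * δ))) := by
  rw [heatKernel, Complex.sq_norm, Complex.normSq_apply, sq, sq]

theorem heatKernel_horizRefl_sub (s : ℝ) (δ : ℝ≥0) (z w : ℂ) :
    heatKernel δ (horizRefl s z - w) = heatKernel δ (z - horizRefl s w) := by
  rw [heatKernel_eq_normSq, heatKernel_eq_normSq]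
  simp only [Complex.sub_re, Complex.sub_im, horizRefl_re, horizRefl_im]
  congr 5
  ring

theorem heatKernel_ne_top (δ : ℝ≥0) (z : ℂ) : heatKernel δ z ≠ ∞ := ENNReal.ofReal_ne_top

theorem heatKernel_sub_horizRefl_le {s : ℝ} {δ : ℝ≥0} {z w : ℂ} (hz : s ≤ z.im) (hw : s ≤ w.im) :
    heatKernel δ (z - horizRefl s w) ≤ heatKernel δ (z - w) := by
  rw [heatKernel_eq_normSq, heatKernel_eq_normSq]
  simp only [Complex.sub_re, Complex.sub_im, horizRefl_re, horizRefl_im]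
  gcongr ENNReal.ofReal (_ * Real.exp (-?_ / _))
  nlinarith [mul_nonneg (sub_nonneg.2 hz) (sub_nonneg.2 hw)]

/-- Reflecting `w` raises the squared distance by `4 (z.im - s) (w.im - s) ≥ 4 r ^ 2`, which costs a
factor of at most `exp (-2 r ^ 2 / δ)` in the kernel. -/
theorem heatKernel_sub_horizRefl_add_le {s r : ℝ} (hr : 0 ≤ r) {δ : ℝ≥0} {z w : ℂ}
    (hz : s + r ≤ z.im) (hw : s + r ≤ w.im) :
    heatKernel δ (z - horizRefl s w) +
      ENNReal.ofReal (1 - Real.exp (-(2 * r ^ 2 / δ))) * heatKernel δ (z - w) ≤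
        heatKernel δ (z - w) := by
  rw [heatKernel_eq_normSq, heatKernel_eq_normSq]
  simp only [Complex.sub_re, Complex.sub_im, horizRefl_re, horizRefl_im]
  have h1 : 0 ≤ 1 - Real.exp (-(2 * r ^ 2 / δ)) := by
    rw [sub_nonneg, Real.exp_le_one_iff, neg_nonpos]
    positivity
  rw [← ENNReal.ofReal_mul h1, ← ENNReal.ofReal_add (by positivity) (by positivity)]
  refine ENNReal.ofReal_le_ofReal ?_
  have h2 : Real.exp (-((z.re - w.re) ^ 2 + (z.im - (2 * s - w.im)) ^ 2) / (2 * δ)) ≤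
      Real.exp (-(2 * r ^ 2 / δ)) *
        Real.exp (-((z.re - w.re) ^ 2 + (z.im - w.im) ^ 2) / (2 * δ)) := by
    rw [← Real.exp_add, Real.exp_le_exp]
    have : -(2 * r ^ 2 / (δ : ℝ)) = -(4 * r ^ 2) / (2 * δ) := by
      rw [neg_div, show 4 * r ^ 2 = 2 * (2 * r ^ 2) by ring, mul_div_mul_left _ _ two_ne_zero]
    rw [this, ← add_div]
    refine div_le_div_of_nonneg_right ?_ (by positivity)
    nlinarith [mul_le_mul (le_sub_iff_add_le'.2 hz) (le_sub_iff_add_le'.2 hw) hr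
      (hr.trans (le_sub_iff_add_le'.2 hz))]
  have h3 : 0 ≤ (2 * Real.pi * (δ : ℝ))⁻¹ := by positivity
  nlinarith [mul_le_mul_of_nonneg_left h2 h3]

/-- The reflection preserves area, so each integral is half the integral of the sum over mirror
pairs. -/
theorem lintegral_le_of_add_horizRefl_le (s : ℝ) {f g : ℂ → ℝ≥0∞} (hf : Measurable f)
    (hg : Measurable g)
    (h : ∀ w, s ≤ w.im → f w + f (horizRefl s w) ≤ g w + g (horizRefl s w)) :
    ∫⁻ w, f w ≤ ∫⁻ w, g w := by
  have hall : ∀ w, f w + f (horizRefl s w) ≤ g w + g (horizRefl s w) := by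
    intro w
    rcases le_total s w.im with hw | hw
    · exact h w hw
    · have := h (horizRefl s w) (by simp; linarith)
      rwa [horizRefl_horizRefl, add_comm, add_comm (g _)] at this
  have key : ∀ {k : ℂ → ℝ≥0∞}, Measurable k →
      ∫⁻ w, (k w + k (horizRefl s w)) = 2 * ∫⁻ w, k w := by
    intro k hk
    rw [lintegral_add_left hk, lintegral_comp_horizRefl s hk, two_mul]
  have := lintegral_mono (μ := volume) hall
  rw [key hf, key hg] at this
  exact (ENNReal.mul_le_mul_iff_right two_ne_zero ENNReal.ofNat_ne_top).1 this

/-! ### The walk of a polarised set -/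

theorem lintegral_heatKernel_sub {δ : ℝ≥0} (hδ : δ ≠ 0) (z : ℂ) :
    ∫⁻ w, heatKernel δ (z - w) = 1 := by
  have := isProbabilityMeasure_heatMeasure hδ
  simpa using (lintegral_add_heatMeasure (t := δ) (measurable_const (a := (1 : ℝ≥0∞))) z).symm

theorem walkProb_le_one (A : Set ℂ) {δ : ℝ≥0} (hδ : δ ≠ 0) (n : ℕ) (z : ℂ) :
    walkProb A δ n z ≤ 1 := by
  induction n generalizing z with
  | zero => exact Set.indicator_le_self' (by simp) z
  | succ n ih =>
    refine (Set.indicator_le_self' (fun _ _ ↦ zero_le) z).trans ?_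
    rw [← lintegral_heatKernel_sub hδ z]
    exact lintegral_mono fun w ↦ mul_le_of_le_one_left zero_le (ih w)

theorem walkProb_mono {A A' : Set ℂ} (h : A ⊆ A') (δ : ℝ≥0) (n : ℕ) (z : ℂ) :
    walkProb A δ n z ≤ walkProb A' δ n z := by
  induction n generalizing z with
  | zero => exact Set.indicator_le_indicator_of_subset h (fun _ ↦ zero_le) z
  | succ n ih =>
    refine (Set.indicator_le_indicator_of_subset h (fun _ ↦ zero_le) z).trans ?_
    refine Set.indicator_le_indicator ?_
    exact lintegral_mono fun w ↦ mul_le_mul_left (ih w) _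

theorem walkProb_eq_zero {A : Set ℂ} {z : ℂ} (hz : z ∉ A) (δ : ℝ≥0) (n : ℕ) :
    walkProb A δ n z = 0 := by
  cases n <;> simp [walkProb, hz]

theorem Measurable.mul_heatKernel_sub {f : ℂ → ℝ≥0∞} (hf : Measurable f) (δ : ℝ≥0) (z : ℂ) :
    Measurable fun w ↦ f w * heatKernel δ (z - w) :=
  hf.mul ((measurable_heatKernel δ).comp (measurable_id.const_sub z))

theorem walkProb_le_walkProb_horizRefl {s : ℝ} {A G : Set ℂ} (hA : MeasurableSet A)
    (hGA : ∀ z ∈ G, horizRefl s z ∈ A) (δ : ℝ≥0) (n : ℕ) (z : ℂ) :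
    walkProb G δ n z ≤ walkProb A δ n (horizRefl s z) := by
  induction n generalizing z with
  | zero =>
    by_cases hz : z ∈ G
    · simp [walkProb, hz, hGA z hz]
    · simp [walkProb, hz]
  | succ n ih =>
    by_cases hz : z ∈ G
    · rw [walkProb, walkProb, Set.indicator_of_mem hz, Set.indicator_of_mem (hGA z hz),
        ← lintegral_comp_horizRefl s ((measurable_walkProb hA δ n).mul_heatKernel_sub δ _)]
      refine lintegral_mono fun w ↦ ?_
      simp only [heatKernel_horizRefl_sub, horizRefl_horizRefl]
      exact mul_le_mul_left (ih w) _
    · simp [walkProb, hz]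

/-- The right side minus the left is `(v₂ - v₁) (α - β) - C c (x - y) α`. By `hv` this is at least
`C (x - y) (α - β - c α)`. -/
theorem ENNReal.polarised_le {v₁ v₂ x y C c α β : ℝ≥0∞} (hv₁ : v₁ ≠ ∞) (hv₂ : v₂ ≠ ∞)
    (hx : x ≠ ∞) (hC : C ≠ ∞) (hc : c ≠ ∞) (hα : α ≠ ∞) (hyx : y ≤ x) (hβα : β ≤ α)
    (hv : v₁ + C * x ≤ v₂ + C * y) (h : x = 0 ∨ β + c * α ≤ α) :
    v₁ * α + C * c * (x * α) + v₂ * β ≤ v₁ * β + C * c * (y * α) + v₂ * α := by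
  have hy : y ≠ ∞ := ne_top_of_le_ne_top hx hyx
  have hβ : β ≠ ∞ := ne_top_of_le_ne_top hα hβα
  lift v₁ to ℝ≥0 using hv₁
  lift v₂ to ℝ≥0 using hv₂
  lift x to ℝ≥0 using hx
  lift y to ℝ≥0 using hy
  lift C to ℝ≥0 using hC
  lift c to ℝ≥0 using hc
  lift α to ℝ≥0 using hα
  lift β to ℝ≥0 using hβ
  norm_cast at *
  rw [← NNReal.coe_le_coe] at *
  push_cast at *
  rcases h with rfl | h
  · have hy0 : (y : ℝ) = 0 := le_antisymm hyx y.2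
    simp only [hy0, NNReal.coe_zero, mul_zero, add_zero, zero_mul] at *
    nlinarith [mul_nonneg (sub_nonneg.2 hv) (sub_nonneg.2 hβα)]
  · replace h : (β : ℝ) + c * α ≤ α := by exact_mod_cast h
    nlinarith [mul_nonneg (sub_nonneg.2 hv) (sub_nonneg.2 hβα),
      mul_nonneg (mul_nonneg C.coe_nonneg (sub_nonneg.2 hyx)) (sub_nonneg.2 h)]

/-- The gain at the mirror point is at least `c ^ n` times the probability that the walk stays in
`G` but not in `A`. In the inductive step the integrals are folded along the line, and one factor
`c` is spent on the kernel gap between points of `G`; the margin `r` keeps this gap positive. -/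
theorem walkProb_polarised_le {s r : ℝ} (hr : 0 < r) {A G : Set ℂ} (hA : MeasurableSet A)
    (hG : MeasurableSet G) (hAσ : ∀ z ∈ A, s ≤ z.im → horizRefl s z ∈ A)
    (hGr : ∀ z ∈ G, s + r ≤ z.im) (hGA : ∀ z ∈ G, horizRefl s z ∈ A) {δ : ℝ≥0} (hδ : δ ≠ 0)
    (n : ℕ) {z : ℂ} (hz : s ≤ z.im) :
    walkProb A δ n z + ENNReal.ofReal (1 - Real.exp (-(2 * r ^ 2 / δ))) ^ n * walkProb G δ n z ≤
      walkProb A δ n (horizRefl s z) +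
        ENNReal.ofReal (1 - Real.exp (-(2 * r ^ 2 / δ))) ^ n * walkProb (G ∩ A) δ n z := by
  have hker := fun z w hz hw ↦
    heatKernel_sub_horizRefl_add_le (s := s) hr.le (δ := δ) (z := z) (w := w) hz hw
  set c := ENNReal.ofReal (1 - Real.exp (-(2 * r ^ 2 / δ))) with hc
  have hc1 : c ≤ 1 := by
    rw [hc, ENNReal.ofReal_le_one]
    linarith [Real.exp_pos (-(2 * r ^ 2 / δ))]
  have hfin : ∀ (E : Set ℂ) n z, walkProb E δ n z ≠ ∞ := fun E n z ↦
    ne_top_of_le_ne_top ENNReal.one_ne_top (walkProb_le_one E hδ n z)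
  induction n generalizing z with
  | zero =>
    by_cases hzA : z ∈ A
    · have := hAσ z hzA hz
      by_cases hzG : z ∈ G <;> simp [walkProb, *]
    · by_cases hzG : z ∈ G
      · simp [walkProb, *]
      · simp [walkProb, hzA, hzG]
  | succ n ih =>
    have hmA := measurable_walkProb hA δ n
    have hmG := measurable_walkProb hG δ n
    have hmI := measurable_walkProb (hG.inter hA) δ n
    have hcn : c ^ n ≠ ∞ := ENNReal.pow_ne_top (ne_top_of_le_ne_top ENNReal.one_ne_top hc1)
    have hrefl : ∀ w, heatKernel δ (horizRefl s z - horizRefl s w) = heatKernel δ (z - w) := by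
      intro w
      rw [heatKernel_horizRefl_sub, horizRefl_horizRefl]
    -- `C = c ^ n` serves starting points in `G`; `C = 0` serves the others, for which the `G` terms
    -- vanish.
    have pol : ∀ C : ℝ≥0∞, (C = 0 ∨ C = c ^ n ∧ z ∈ G) →
        (∫⁻ w, walkProb A δ n w * heatKernel δ (z - w)) +
            C * c * ∫⁻ w, walkProb G δ n w * heatKernel δ (z - w) ≤
          (∫⁻ w, walkProb A δ n w * heatKernel δ (horizRefl s z - w)) +
            C * c * ∫⁻ w, walkProb (G ∩ A) δ n w * heatKernel δ (z - w) := by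
      intro C hCc
      rw [← lintegral_const_mul _ (hmG.mul_heatKernel_sub δ z), ← lintegral_const_mul _ (hmI.mul_heatKernel_sub δ z),
        ← lintegral_add_left (hmA.mul_heatKernel_sub δ z), ← lintegral_add_left (hmA.mul_heatKernel_sub δ (horizRefl s z))]
      refine lintegral_le_of_add_horizRefl_le s
        ((hmA.mul_heatKernel_sub δ z).add ((hmG.mul_heatKernel_sub δ z).const_mul _))
        ((hmA.mul_heatKernel_sub δ (horizRefl s z)).add ((hmI.mul_heatKernel_sub δ z).const_mul _)) fun w hw ↦ ?_
      have hσG : horizRefl s w ∉ G := fun h ↦ by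
        have := hGr _ h
        simp only [horizRefl_im] at this
        linarith
      rw [walkProb_eq_zero hσG, walkProb_eq_zero (A := G ∩ A) (fun h ↦ hσG h.1), hrefl,
        heatKernel_horizRefl_sub]
      simp only [zero_mul, mul_zero, add_zero]
      have hyx := walkProb_mono (Set.inter_subset_left (s := G) (t := A)) δ n w
      have hle := heatKernel_sub_horizRefl_le (δ := δ) hz hw
      have hv : walkProb A δ n w + c ^ n * walkProb G δ n w ≤
        walkProb A δ n (horizRefl s w) + c ^ n * walkProb (G ∩ A) δ n w := ih hw
      rcases hCc with rfl | ⟨rfl, hzG⟩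
      · have hv' : walkProb A δ n w ≤ walkProb A δ n (horizRefl s w) := by
          have h1 : c ^ n * walkProb (G ∩ A) δ n w ≤ c ^ n * walkProb G δ n w := by gcongr
          have h2 := hv.trans (add_le_add_right h1 _)
          exact (ENNReal.add_le_add_iff_right (ENNReal.mul_ne_top hcn (hfin _ _ _))).1 h2
        simpa using ENNReal.polarised_le (x := 0) (y := 0) (C := 0) (c := 0) (hfin A n w)
          (hfin A n (horizRefl s w)) (by simp) (by simp) (by simp) (heatKernel_ne_top δ (z - w))
          le_rfl hle (by simpa using hv') (.inl rfl)
      · refine ENNReal.polarised_le (hfin _ _ _) (hfin _ _ _) (hfin _ _ _) hcn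
          (ne_top_of_le_ne_top ENNReal.one_ne_top hc1) (heatKernel_ne_top _ _) hyx hle hv ?_
        by_cases hwG : w ∈ G
        · exact .inr (hker z w (hGr z hzG) (hGr w hwG))
        · exact .inl (walkProb_eq_zero hwG δ n)
    by_cases hzG : z ∈ G
    · by_cases hzA : z ∈ A
      · simp only [walkProb, Set.indicator_of_mem hzG, Set.indicator_of_mem hzA,
          Set.indicator_of_mem (hAσ z hzA hz), Set.indicator_of_mem (Set.mem_inter hzG hzA),
          pow_succ]
        exact pol (c ^ n) (.inr ⟨rfl, hzG⟩)
      -- For `z` in `G` but not in `A`, reflecting the whole walk suffices.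
      · rw [walkProb_eq_zero hzA, zero_add]
        refine le_add_right ((mul_le_of_le_one_left zero_le (pow_le_one' hc1 _)).trans ?_)
        exact walkProb_le_walkProb_horizRefl hA hGA δ (n + 1) z
    · rw [walkProb_eq_zero hzG, walkProb_eq_zero (A := G ∩ A) (fun h ↦ hzG h.1), mul_zero, add_zero,
        add_zero]
      by_cases hzA : z ∈ A
      · simp only [walkProb, Set.indicator_of_mem hzA, Set.indicator_of_mem (hAσ z hzA hz)]
        simpa using pol 0 (.inl rfl)
      · rw [walkProb_eq_zero hzA]
        exact zero_le

/-- By Bernoulli's inequality the power is at least `1 - N exp (-κ N)`. -/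
theorem tendsto_one_sub_exp_pow {κ : ℝ} (hκ : 0 < κ) :
    Tendsto (fun N : ℕ ↦ (1 - Real.exp (-(κ * N))) ^ N) atTop (𝓝 1) := by
  have h1 : Tendsto (fun N : ℕ ↦ κ⁻¹ * ((κ * N) ^ 1 * Real.exp (-(κ * N)))) atTop (𝓝 0) := by
    have h2 : Tendsto (fun N : ℕ ↦ κ * (N : ℝ)) atTop atTop :=
      tendsto_natCast_atTop_atTop.const_mul_atTop hκ
    simpa using ((Real.tendsto_pow_mul_exp_neg_atTop_nhds_zero 1).comp h2).const_mul κ⁻¹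
  have h3 : Tendsto (fun N : ℕ ↦ 1 - κ⁻¹ * ((κ * N) ^ 1 * Real.exp (-(κ * N)))) atTop (𝓝 1) := by
    simpa using h1.const_sub 1
  have hle : ∀ N : ℕ, Real.exp (-(κ * N)) ≤ 1 := fun N ↦ by
    rw [Real.exp_le_one_iff, neg_nonpos]
    positivity
  refine tendsto_of_tendsto_of_tendsto_of_le_of_le h3 tendsto_const_nhds (fun N ↦ ?_) fun N ↦ ?_
  · have := one_add_mul_le_pow (a := -Real.exp (-(κ * N))) (by linarith [hle N]) N
    refine le_trans (le_of_eq ?_) this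
    field_simp
    ring
  · exact pow_le_one₀ (by linarith [hle N]) (by linarith [Real.exp_pos (-(κ * N))])

theorem IsContPlanarBrownian.measure_stay_polarised_le {Ω : Type*} [MeasurableSpace Ω]
    {P : Measure Ω} {B : ℝ≥0 → Ω → ℂ} (hB : IsContPlanarBrownian B P) {s r : ℝ} (hr : 0 < r)
    {A G : Set ℂ} (hA : IsClosed A) (hG : IsClosed G)
    (hAσ : ∀ z ∈ A, s ≤ z.im → horizRefl s z ∈ A) (hGr : ∀ z ∈ G, s + r ≤ z.im)
    (hGA : ∀ z ∈ G, horizRefl s z ∈ A) {t : ℝ≥0} (ht : t ≠ 0) {z : ℂ} (hz : s ≤ z.im) :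
    P {ω | ∀ u ≤ t, z + B u ω ∈ A} + P {ω | ∀ u ≤ t, z + B u ω ∈ G} ≤
      P {ω | ∀ u ≤ t, horizRefl s z + B u ω ∈ A} + P {ω | ∀ u ≤ t, z + B u ω ∈ G ∩ A} := by
  have hc : Tendsto (fun m : ℕ ↦
      ENNReal.ofReal (1 - Real.exp (-(2 * r ^ 2 / (t / 2 ^ m : ℝ≥0)))) ^ 2 ^ m) atTop (𝓝 1) := by
    have ht' : (0 : ℝ) < t := NNReal.coe_pos.2 (pos_iff_ne_zero.2 ht)
    -- With `N = 2 ^ m` steps of length `t / N`, the exponent `2 r ^ 2 / δ` equals `(2 r ^ 2 / t)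
    -- N`.
    have h1 := (tendsto_one_sub_exp_pow (κ := 2 * r ^ 2 / t) (by positivity)).comp
      (tendsto_pow_atTop_atTop_of_one_lt (one_lt_two (α := ℕ)))
    have h2 := (ENNReal.continuous_ofReal.tendsto 1).comp h1
    rw [ENNReal.ofReal_one] at h2
    refine h2.congr fun m ↦ ?_
    simp only [Function.comp]
    rw [ENNReal.ofReal_pow]
    · congr 5
      push_cast
      field_simp
    · rw [sub_nonneg, Real.exp_le_one_iff, neg_nonpos]
      positivity
  have hl := (hB.tendsto_walkProb hA ht z).add (ENNReal.Tendsto.mul hc (.inl one_ne_zero)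
    (hB.tendsto_walkProb hG ht z) (.inr ENNReal.one_ne_top))
  have hr' := (hB.tendsto_walkProb hA ht (horizRefl s z)).add
    (ENNReal.Tendsto.mul hc (.inl one_ne_zero)
      (hB.tendsto_walkProb (hG.inter hA) ht z) (.inr ENNReal.one_ne_top))
  rw [one_mul] at hl hr'
  exact le_of_tendsto_of_tendsto' hl hr' fun m ↦ walkProb_polarised_le hr hA.measurableSet
    hG.measurableSet hAσ hGr hGA (by positivity) _ hz

/-! ### Polarisation in continuous time -/

theorem edist_horizRefl (s : ℝ) (z w : ℂ) :
    edist (horizRefl s z) w = edist z (horizRefl s w) := by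
  rw [edist_dist, edist_dist, Complex.dist_eq_re_im, Complex.dist_eq_re_im]
  simp only [horizRefl_re, horizRefl_im]
  congr 3
  ring

theorem edist_le_edist_horizRefl {s : ℝ} {z w : ℂ} (hz : s ≤ z.im) (hw : s ≤ w.im) :
    edist z w ≤ edist (horizRefl s z) w := by
  rw [edist_dist, edist_dist, Complex.dist_eq_re_im, Complex.dist_eq_re_im]
  simp only [horizRefl_re, horizRefl_im]
  gcongr ENNReal.ofReal √(_ + ?_)
  nlinarith [mul_nonneg (sub_nonneg.2 hz) (sub_nonneg.2 hw)]

/-- A point `w` outside `U` and above the line is no closer to the mirror image of `z` than to `z`.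
If `w` is below the line, its mirror image is also outside `U`, and distances are preserved. -/
theorem horizRefl_mem_innerPart {s : ℝ} {U : Set ℂ}
    (hU : ∀ z ∈ U, s ≤ z.im → horizRefl s z ∈ U) (k : ℕ) {z : ℂ} (hz : z ∈ innerPart U k)
    (hs : s ≤ z.im) : horizRefl s z ∈ innerPart U k := by
  rw [innerPart, Set.mem_ofPred_eq] at hz ⊢
  refine hz.trans (Metric.le_infEDist.2 fun w hw ↦ ?_)
  rcases le_total s w.im with h | h
  · exact (Metric.infEDist_le_edist_of_mem hw).trans (edist_le_edist_horizRefl hs h)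
  · rw [edist_horizRefl]
    refine Metric.infEDist_le_edist_of_mem fun hw' ↦ hw ?_
    simpa using hU _ hw' (by simp; linarith)

/-- The part of the mirror image of `U` above the horizontal line of height `s`. -/
def upperRefl (s : ℝ) (U : Set ℂ) : Set ℂ := {z | s < z.im ∧ horizRefl s z ∈ U}

theorem isOpen_upperRefl (s : ℝ) {U : Set ℂ} (hU : IsOpen U) : IsOpen (upperRefl s U) :=
  (isOpen_lt continuous_const Complex.continuous_im).inter (hU.preimage (continuous_horizRefl s))

theorem le_im_of_mem_innerPart_upperRefl {s : ℝ} {U : Set ℂ} {m : ℕ} {z : ℂ}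
    (hz : z ∈ innerPart (upperRefl s U) m) : s + ((m : ℝ) + 1)⁻¹ ≤ z.im := by
  have h0 := (innerPart_subset _ _ hz).1
  rw [innerPart, Set.mem_ofPred_eq] at hz
  have h1 : (⟨z.re, s⟩ : ℂ) ∈ (upperRefl s U)ᶜ := fun h ↦ lt_irrefl _ h.1
  have h2 := hz.trans (Metric.infEDist_le_edist_of_mem h1)
  have h3 : dist z ⟨z.re, s⟩ = z.im - s := by
    rw [Complex.dist_eq_re_im]
    simp only [sub_self, ne_eq, OfNat.ofNat_ne_zero, not_false_eq_true, zero_pow, zero_add]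
    exact Real.sqrt_sq (by linarith)
  have h4 : ((m : ℝ≥0∞) + 1)⁻¹ = ENNReal.ofReal (((m : ℝ) + 1)⁻¹) := by
    rw [ENNReal.ofReal_inv_of_pos (by positivity), ENNReal.ofReal_add (by positivity) zero_le_one]
    simp
  rw [edist_dist, h3, h4, ENNReal.ofReal_le_ofReal_iff (by linarith)] at h2
  linarith

theorem horizRefl_mem_innerPart_of_upperRefl {s : ℝ} {U : Set ℂ} {m : ℕ} {z : ℂ}
    (hz : z ∈ innerPart (upperRefl s U) m) : horizRefl s z ∈ innerPart U m := by
  rw [innerPart, Set.mem_ofPred_eq] at hz ⊢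
  refine hz.trans (Metric.le_infEDist.2 fun w hw ↦ ?_)
  rw [edist_horizRefl]
  exact Metric.infEDist_le_edist_of_mem fun h ↦ hw (by simpa using h.2)

namespace IsContPlanarBrownian

variable {Ω : Type*} [MeasurableSpace Ω] {P : Measure Ω} {B : ℝ≥0 → Ω → ℂ}

theorem measure_stay_le_horizRefl (hB : IsContPlanarBrownian B P) {s : ℝ} {U : Set ℂ}
    (hU : IsOpen U) (hUσ : ∀ z ∈ U, s ≤ z.im → horizRefl s z ∈ U) {t : ℝ≥0} (ht : t ≠ 0)
    {z : ℂ} (hz : s ≤ z.im) :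
    P {ω | ∀ u ≤ t, z + B u ω ∈ U} ≤ P {ω | ∀ u ≤ t, horizRefl s z + B u ω ∈ U} := by
  refine le_of_tendsto_of_tendsto' (hB.tendsto_measure_stay_innerPart hU z t)
    (hB.tendsto_measure_stay_innerPart hU (horizRefl s z) t) fun k ↦ ?_
  have h := hB.measure_stay_polarised_le (s := s) one_pos (isClosed_innerPart U k) isClosed_empty
    (fun z hz h ↦ horizRefl_mem_innerPart hUσ k hz h) (by simp) (by simp) ht hz
  have h0 : ∀ z, {ω | ∀ u ≤ t, z + B u ω ∈ (∅ : Set ℂ)} = ∅ := fun z ↦ by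
    ext ω
    simpa using ⟨0, zero_le⟩
  simpa only [Set.empty_inter, h0, measure_empty, add_zero] using h

/-- The polarised inequality is applied to inner parts: `k` (for `U`) tends to infinity with `m`
(for the mirror image) fixed, and the resulting null sets are united over `m`. The margin above the
line is `1 / (m + 1)`. -/
theorem measure_stay_upperRefl_diff_eq_zero (hB : IsContPlanarBrownian B P) {s : ℝ} {U : Set ℂ}
    (hU : IsOpen U) (hUσ : ∀ z ∈ U, s ≤ z.im → horizRefl s z ∈ U) {t : ℝ≥0} (ht : t ≠ 0)
    {z : ℂ} (hz : s ≤ z.im)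
    (heq : P {ω | ∀ u ≤ t, horizRefl s z + B u ω ∈ U} ≤ P {ω | ∀ u ≤ t, z + B u ω ∈ U}) :
    P {ω | (∀ u ≤ t, z + B u ω ∈ upperRefl s U) ∧ ¬ ∀ u ≤ t, z + B u ω ∈ U} = 0 := by
  have := hB.isProbabilityMeasure
  have hV := isOpen_upperRefl s hU
  have key : ∀ m, P ({ω | ∀ u ≤ t, z + B u ω ∈ innerPart (upperRefl s U) m} \
      {ω | ∀ u ≤ t, z + B u ω ∈ U}) = 0 := by
    intro m
    set E := {ω | ∀ u ≤ t, z + B u ω ∈ innerPart (upperRefl s U) m}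
    set F := {ω | ∀ u ≤ t, z + B u ω ∈ U}
    have hF : MeasurableSet F := hB.measurableSet_stay_of_isOpen hU z t
    have h1 : P F + P E ≤ P {ω | ∀ u ≤ t, horizRefl s z + B u ω ∈ U} + P (E ∩ F) := by
      refine le_of_tendsto_of_tendsto ((hB.tendsto_measure_stay_innerPart hU z t).add_const _)
        ((hB.tendsto_measure_stay_innerPart hU (horizRefl s z) t).add_const _) ?_
      filter_upwards [eventually_ge_atTop m] with k hk
      refine (hB.measure_stay_polarised_le (s := s) (r := ((m : ℝ) + 1)⁻¹) (by positivity)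
        (isClosed_innerPart U k) (isClosed_innerPart (upperRefl s U) m)
        (fun z hz h ↦ horizRefl_mem_innerPart hUσ k hz h)
        (fun z hz ↦ le_im_of_mem_innerPart_upperRefl hz)
        (fun z hz ↦ innerPart_mono U hk (horizRefl_mem_innerPart_of_upperRefl hz)) ht hz).trans ?_
      gcongr
      exact fun ω hω ↦ ⟨fun u hu ↦ (hω u hu).1, fun u hu ↦ innerPart_subset U k (hω u hu).2⟩
    have h2 : P E ≤ P (E ∩ F) :=
      (ENNReal.add_le_add_iff_left (measure_ne_top P F)).1 (h1.trans (add_le_add_left heq _))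
    have h3 := measure_inter_add_sdiff (μ := P) E hF
    have h4 : P (E ∩ F) + P (E \ F) ≤ P (E ∩ F) + 0 := by rwa [h3, add_zero]
    exact le_antisymm ((ENNReal.add_le_add_iff_left (measure_ne_top P _)).1 h4) zero_le
  refine measure_mono_null ?_ (measure_iUnion_null key)
  rintro ω ⟨h1, h2⟩
  rw [← mem_openStay hV (hB.continuous_add z ω), openStay, Set.mem_iUnion] at h1
  obtain ⟨m, hm⟩ := h1
  rw [mem_denseStay (isClosed_innerPart _ m) (hB.continuous_add z ω)] at hm
  exact Set.mem_iUnion.2 ⟨m, hm, h2⟩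

/-! ### The support of planar Brownian motion -/

/-- Both sides are limits of the same walk probabilities. This lets constants found for one motion
serve all its time shifts. -/
theorem measure_stay_eq {Ω' : Type*} [MeasurableSpace Ω'] {P' : Measure Ω'} {B' : ℝ≥0 → Ω' → ℂ}
    (hB : IsContPlanarBrownian B P) (hB' : IsContPlanarBrownian B' P') {A : Set ℂ}
    (hA : IsClosed A) {t : ℝ≥0} (ht : t ≠ 0) (z : ℂ) :
    P {ω | ∀ s ≤ t, z + B s ω ∈ A} = P' {ω | ∀ s ≤ t, z + B' s ω ∈ A} :=
  tendsto_nhds_unique (hB.tendsto_walkProb hA ht z) (hB'.tendsto_walkProb hA ht z)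

theorem tendsto_measure_stay_closedBall (hB : IsContPlanarBrownian B P) {r : ℝ} (hr : 0 < r) :
    Tendsto (fun n : ℕ ↦ P {ω | ∀ s ≤ ((n : ℝ≥0) + 1)⁻¹, B s ω ∈ Metric.closedBall 0 r}) atTop
      (𝓝 1) := by
  have := hB.isProbabilityMeasure
  have hU : (⋃ n : ℕ, {ω | ∀ s ≤ ((n : ℝ≥0) + 1)⁻¹, B s ω ∈ Metric.closedBall 0 r}) =
      Set.univ := by
    refine Set.eq_univ_of_forall fun ω ↦ ?_
    have hev : ∀ᶠ s in 𝓝 (0 : ℝ≥0), B s ω ∈ Metric.closedBall 0 r := by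
      refine (hB.cont ω).tendsto 0 ?_
      rw [hB.zero]
      exact Metric.closedBall_mem_nhds 0 hr
    obtain ⟨δ, hδ, hball⟩ := Metric.eventually_nhds_iff.1 hev
    obtain ⟨n, hn⟩ := exists_nat_one_div_lt hδ
    refine Set.mem_iUnion.2 ⟨n, fun s hs ↦ hball ?_⟩
    rw [NNReal.dist_eq, NNReal.coe_zero, sub_zero, abs_of_nonneg s.coe_nonneg]
    refine lt_of_le_of_lt ?_ hn
    rw [one_div]
    exact_mod_cast hs
  rw [← measure_univ (μ := P), ← hU]
  refine tendsto_measure_iUnion_atTop fun n m hnm ω hω s hs ↦ hω s (hs.trans ?_)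
  gcongr

theorem _root_.heatMeasure_eq_map_smul {h : ℝ≥0} (hh : h ≠ 0) :
    heatMeasure h = (heatMeasure 1).map (fun z ↦ (√(h : ℝ)) • z) := by
  have h1 : gaussianReal 0 h = (gaussianReal 0 1).map (√(h : ℝ) * ·) := by
    rw [gaussianReal_map_const_mul, mul_zero, mul_one]
    congr 1
    exact NNReal.eq (Real.sq_sqrt h.2).symm
  have hm : Measurable (√(h : ℝ) * ·) := measurable_const_mul _
  rw [heatMeasure_eq_map hh, heatMeasure_eq_map one_ne_zero, h1,
    Measure.map_prod_map _ _ hm hm, Measure.map_map (MeasurableEquiv.measurable _) (hm.prodMap hm),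
    Measure.map_map (measurable_const_smul _) (MeasurableEquiv.measurable _)]
  congr 1
  ext p
  refine Complex.ext ?_ ?_ <;> simp

/-- The law at time `h` is the law at time 1 scaled by `√h ≤ 1`. The ball is convex with 0 on its
boundary, so this scaling maps it into itself. -/
theorem _root_.heatMeasure_one_ball_le {h : ℝ≥0} (hh : h ≠ 0) (h1 : h ≤ 1) (v : ℂ) :
    heatMeasure 1 (Metric.ball (-v) ‖v‖) ≤ heatMeasure h (Metric.ball (-v) ‖v‖) := by
  rw [heatMeasure_eq_map_smul hh, Measure.map_apply (measurable_const_smul _)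
    Metric.isOpen_ball.measurableSet]
  refine measure_mono fun z hz ↦ ?_
  have hs0 : 0 < √(h : ℝ) := Real.sqrt_pos.2 (NNReal.coe_pos.2 (pos_iff_ne_zero.2 hh))
  have hs1 : √(h : ℝ) ≤ 1 := Real.sqrt_le_one.2 (by exact_mod_cast h1)
  rw [Set.mem_preimage, mem_ball_iff_norm, sub_neg_eq_add]
  rw [mem_ball_iff_norm, sub_neg_eq_add] at hz
  have he : √(h : ℝ) • z + v = √(h : ℝ) • (z + v) + (1 - √(h : ℝ)) • v := by
    rw [smul_add, sub_smul, one_smul]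
    ring
  calc ‖√(h : ℝ) • z + v‖ ≤ ‖√(h : ℝ) • (z + v)‖ + ‖(1 - √(h : ℝ)) • v‖ := he ▸ norm_add_le _ _
    _ = √(h : ℝ) * ‖z + v‖ + (1 - √(h : ℝ)) * ‖v‖ := by
      rw [norm_smul, norm_smul, Real.norm_of_nonneg hs0.le,
        Real.norm_of_nonneg (sub_nonneg.2 hs1)]
    _ < ‖v‖ := by nlinarith

theorem _root_.heatMeasure_ball_pos {h : ℝ≥0} (hh : h ≠ 0) (z : ℂ) {r : ℝ} (hr : 0 < r) :
    0 < heatMeasure h (Metric.ball z r) := by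
  rw [pos_iff_ne_zero]
  intro h0
  have hac : (volume : Measure ℂ) ≪ heatMeasure h := by
    refine withDensity_absolutelyContinuous' (measurable_heatKernel h).aemeasurable
      (.of_forall fun z ↦ ?_)
    have hh' : (0 : ℝ) < h := NNReal.coe_pos.2 (pos_iff_ne_zero.2 hh)
    exact (ENNReal.ofReal_pos.2 (by positivity)).ne'
  exact (Metric.measure_ball_pos volume z hr).ne' (hac h0)

/-- As `h → 0` the probability of staying in the small ball tends to 1, while that of ending in the
ball about `-v` stays bounded below. The two eventually sum to more than 1, so the events overlap; a
slight shrinking by `ε` preserves this. -/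
theorem exists_step_pos (hB : IsContPlanarBrownian B P) {v : ℂ} (hv : v ≠ 0) {r : ℝ}
    (hr : 0 < r) : ∃ h : ℝ≥0, h ≠ 0 ∧ ∃ ε > 0, ∀ B' : ℝ≥0 → Ω → ℂ, IsContPlanarBrownian B' P →
      0 < P {ω | (∀ u ≤ h, B' u ω ∈ Metric.closedBall 0 r) ∧
        B' h ω ∈ Metric.ball (-v) (‖v‖ - ε)} := by
  have := hB.isProbabilityMeasure
  have hc0 : 0 < heatMeasure 1 (Metric.ball (-v) ‖v‖) :=
    heatMeasure_ball_pos one_ne_zero _ (norm_pos_iff.2 hv)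
  have hlt : 1 - heatMeasure 1 (Metric.ball (-v) ‖v‖) < 1 :=
    ENNReal.sub_lt_self ENNReal.one_ne_top one_ne_zero hc0.ne'
  obtain ⟨n, hn⟩ := ((hB.tendsto_measure_stay_closedBall hr).eventually (lt_mem_nhds hlt)).exists
  set h : ℝ≥0 := ((n : ℝ≥0) + 1)⁻¹ with hh
  have hh0 : h ≠ 0 := by positivity
  have hh1 : h ≤ 1 := inv_le_one_of_one_le₀ (by simp)
  have hlt2 : 1 - heatMeasure h (Metric.ball (-v) ‖v‖) <
      P {ω | ∀ s ≤ h, B s ω ∈ Metric.closedBall 0 r} :=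
    (tsub_le_tsub_left (heatMeasure_one_ball_le hh0 hh1 v) 1).trans_lt hn
  have hlt3 : 1 < P {ω | ∀ s ≤ h, B s ω ∈ Metric.closedBall 0 r} +
      heatMeasure h (Metric.ball (-v) ‖v‖) := by
    have := isProbabilityMeasure_heatMeasure hh0
    exact (ENNReal.sub_lt_iff_lt_right (measure_ne_top _ _) prob_le_one).1 hlt2
  have hU : (⋃ k : ℕ, Metric.ball (-v) (‖v‖ - 1 / ((k : ℝ) + 1))) = Metric.ball (-v) ‖v‖ := by
    ext z
    simp only [Set.mem_iUnion, Metric.mem_ball]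
    constructor
    · rintro ⟨k, hk⟩
      have : 0 < 1 / ((k : ℝ) + 1) := by positivity
      linarith
    · intro hz
      obtain ⟨k, hk⟩ := exists_nat_one_div_lt (sub_pos.2 hz)
      exact ⟨k, by linarith⟩
  have hlim : Tendsto (fun k : ℕ ↦ heatMeasure h (Metric.ball (-v) (‖v‖ - 1 / ((k : ℝ) + 1))))
      atTop (𝓝 (heatMeasure h (Metric.ball (-v) ‖v‖))) := by
    rw [← hU]
    refine tendsto_measure_iUnion_atTop fun k l hkl ↦ Metric.ball_subset_ball ?_
    gcongr
  obtain ⟨k, hk⟩ := (((tendsto_const_nhds (x := P {ω | ∀ s ≤ h, B s ω ∈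
    Metric.closedBall 0 r})).add hlim).eventually (lt_mem_nhds hlt3)).exists
  refine ⟨h, hh0, 1 / ((k : ℝ) + 1), by positivity, fun B' hB' ↦ ?_⟩
  have e1 : P {ω | ∀ s ≤ h, B s ω ∈ Metric.closedBall 0 r} =
      P {ω | ∀ s ≤ h, B' s ω ∈ Metric.closedBall 0 r} := by
    simpa using hB.measure_stay_eq hB' (Metric.isClosed_closedBall (x := (0 : ℂ)) (ε := r)) hh0 0
  have e2 : heatMeasure h (Metric.ball (-v) (‖v‖ - 1 / ((k : ℝ) + 1))) =
      P {ω | B' h ω ∈ Metric.ball (-v) (‖v‖ - 1 / ((k : ℝ) + 1))} := by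
    rw [← hB'.law_eval hh0, Measure.map_apply (hB'.meas h) Metric.isOpen_ball.measurableSet]
    rfl
  rw [e1, e2] at hk
  rw [pos_iff_ne_zero]
  intro h0
  have hm : MeasurableSet {ω | B' h ω ∈ Metric.ball (-v) (‖v‖ - 1 / ((k : ℝ) + 1))} :=
    hB'.meas h Metric.isOpen_ball.measurableSet
  have := measure_union_add_inter (μ := P) {ω | ∀ s ≤ h, B' s ω ∈ Metric.closedBall 0 r} hm
  rw [← this] at hk
  have h0' : P ({ω | ∀ s ≤ h, B' s ω ∈ Metric.closedBall 0 r} ∩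
      {ω | B' h ω ∈ Metric.ball (-v) (‖v‖ - 1 / ((k : ℝ) + 1))}) = 0 := h0
  rw [h0', add_zero] at hk
  exact absurd prob_le_one (not_le.2 hk)

/-- A path that stays in `V` up to time `t` and ends in `O`, followed by a step with positive
probability, has positive probability. -/
theorem measure_stay_step_pos (hB : IsContPlanarBrownian B P) {V : Set ℂ} (hV : IsOpen V)
    {O : Set ℂ} (hO : MeasurableSet O) {O' : Set ℂ} (hO' : MeasurableSet O') {z : ℂ}
    {t h : ℝ≥0} {r : ℝ} (h1 : 0 < P {ω | (∀ u ≤ t, z + B u ω ∈ V) ∧ z + B t ω ∈ O})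
    (h2 : 0 < P {ω | (∀ u ≤ h, B (t + u) ω - B t ω ∈ Metric.closedBall 0 r) ∧
      B (t + h) ω - B t ω ∈ O'}) :
    0 < P ({ω | (∀ u ≤ t, z + B u ω ∈ V) ∧ z + B t ω ∈ O} ∩
      {ω | (∀ u ≤ h, B (t + u) ω - B t ω ∈ Metric.closedBall 0 r) ∧
        B (t + h) ω - B t ω ∈ O'}) := by
  have e1 : {ω | (∀ u ≤ t, z + B u ω ∈ V) ∧ z + B t ω ∈ O} =
      (fun ω (u : ℝ≥0) ↦ B (min u t) ω) ⁻¹'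
        {x | (fun u ↦ z + x u) ∈ openStay V t ∧ z + x t ∈ O} := by
    ext ω
    have hc : Continuous fun u ↦ z + B (min u t) ω :=
      (hB.continuous_add z ω).comp (continuous_id.min continuous_const)
    simp only [Set.mem_preimage, Set.mem_ofPred_eq, mem_openStay hV hc, min_self]
    refine and_congr (forall₂_congr fun u hu ↦ ?_) Iff.rfl
    rw [min_eq_left hu]
  have e2 : {ω | (∀ u ≤ h, B (t + u) ω - B t ω ∈ Metric.closedBall 0 r) ∧
      B (t + h) ω - B t ω ∈ O'} = (fun ω (u : ℝ≥0) ↦ B (t + u) ω - B t ω) ⁻¹'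
        {x | x ∈ denseStay (Metric.closedBall 0 r) h ∧ x h ∈ O'} := by
    ext ω
    simp only [Set.mem_preimage, Set.mem_ofPred_eq,
      mem_denseStay Metric.isClosed_closedBall ((hB.shift t).cont ω)]
  have m1 : MeasurableSet {x : ℝ≥0 → ℂ | (fun u ↦ z + x u) ∈ openStay V t ∧ z + x t ∈ O} := by
    have hz : Measurable fun (x : ℝ≥0 → ℂ) u ↦ z + x u := by fun_prop
    have hzt : Measurable fun x : ℝ≥0 → ℂ ↦ z + x t := by fun_prop
    exact (hz (measurableSet_openStay V t)).inter (hzt hO)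
  have m2 : MeasurableSet {x : ℝ≥0 → ℂ | x ∈ denseStay (Metric.closedBall 0 r) h ∧ x h ∈ O'} :=
    (measurableSet_denseStay Metric.isClosed_closedBall.measurableSet h).inter
      (measurable_pi_apply h hO')
  rw [e1] at h1 ⊢
  rw [e2] at h2 ⊢
  rw [(hB.indep t).measure_inter_preimage_eq_mul _ _ m1 m2]
  exact ENNReal.mul_pos h1.ne' h2.ne'

/-- In an open connected set, Brownian motion visits every neighbourhood of every point with
positive probability before leaving the set. -/
theorem exists_measure_stay_pos (hB : IsContPlanarBrownian B P) {V : Set ℂ} (hV : IsOpen V)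
    (hVc : IsPreconnected V) {z : ℂ} (hz : z ∈ V) {w : ℂ} (hw : w ∈ V) {ε : ℝ} (hε : 0 < ε) :
    ∃ t, 0 < P {ω | (∀ u ≤ t, z + B u ω ∈ V) ∧ z + B t ω ∈ Metric.ball w ε} := by
  have := hB.isProbabilityMeasure
  set S : Set ℂ := {w | w ∈ V ∧ ∀ ε > 0, ∃ t, 0 < P {ω | (∀ u ≤ t, z + B u ω ∈ V) ∧
    z + B t ω ∈ Metric.ball w ε}}
  -- From a reachable point some reachable point is strictly closer to any target `q`, by a step
  -- with `v = w₀ - q`.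
  have hstep : ∀ w₀ ∈ S, ∀ q ≠ w₀, ∃ w ∈ S, dist w q < dist w₀ q := by
    rintro w₀ ⟨hw₀V, hw₀⟩ q hq
    obtain ⟨δ, hδ, hball⟩ := Metric.isOpen_iff.1 hV w₀ hw₀V
    obtain ⟨h, hh, ε, hε, hpos⟩ := hB.exists_step_pos (sub_ne_zero.2 hq.symm)
      (half_pos hδ)
    obtain ⟨t, ht⟩ := hw₀ (min ε (δ / 2)) (lt_min hε (half_pos hδ))
    have hp := hB.measure_stay_step_pos hV Metric.isOpen_ball.measurableSet
      Metric.isOpen_ball.measurableSet ht (hpos _ (hB.shift t))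
    set E := {ω | ∀ u ≤ t + h, z + B u ω ∈ V}
    set O := Metric.ball q (dist w₀ q) ∩ V
    have hO : MeasurableSet O := (Metric.isOpen_ball.inter hV).measurableSet
    have hmz : Measurable fun ω ↦ z + B (t + h) ω := (hB.meas _).const_add z
    have hμ : ((P.restrict E).map fun ω ↦ z + B (t + h) ω) O ≠ 0 := by
      rw [Measure.map_apply hmz hO, Measure.restrict_apply (hmz hO)]
      refine (hp.trans_le (measure_mono ?_)).ne'
      rintro ω ⟨⟨h1, h2⟩, h3, h4⟩
      have hE : ω ∈ E := by
        intro u hu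
        rcases le_total u t with hut | hut
        · exact h1 u hut
        · obtain ⟨u, rfl⟩ := exists_add_of_le hut
          refine hball ?_
          have h5 := h3 u (by simpa using hu)
          rw [mem_closedBall_zero_iff] at h5
          rw [mem_ball_iff_norm] at h2 ⊢
          calc ‖z + B (t + u) ω - w₀‖ = ‖(z + B t ω - w₀) + (B (t + u) ω - B t ω)‖ := by ring_nf
            _ ≤ ‖z + B t ω - w₀‖ + ‖B (t + u) ω - B t ω‖ := norm_add_le _ _
            _ < δ := by linarith [min_le_right ε (δ / 2)]
      refine ⟨⟨?_, hE _ le_rfl⟩, hE⟩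
      rw [mem_ball_iff_norm] at h2 h4
      rw [mem_ball_iff_norm, dist_eq_norm]
      calc ‖z + B (t + h) ω - q‖
          = ‖(z + B t ω - w₀) + (B (t + h) ω - B t ω - -(w₀ - q))‖ := by ring_nf
        _ ≤ ‖z + B t ω - w₀‖ + ‖B (t + h) ω - B t ω - -(w₀ - q)‖ := norm_add_le _ _
        _ < ‖w₀ - q‖ := by linarith [min_le_left ε (δ / 2)]
    -- The law of the endpoint charges `O`, hence charges every neighbourhood of some point of `O`.
    obtain ⟨w, hwO, hw⟩ := exists_mem_forall_mem_nhdsWithin_pos_measure hμ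
    refine ⟨w, ⟨hwO.2, fun ε hε ↦ ⟨t + h, ?_⟩⟩, hwO.1⟩
    have := hw _ (mem_nhdsWithin_of_mem_nhds (Metric.ball_mem_nhds w hε))
    rw [Measure.map_apply hmz Metric.isOpen_ball.measurableSet,
      Measure.restrict_apply (hmz Metric.isOpen_ball.measurableSet)] at this
    exact this.trans_le (measure_mono fun ω hω ↦ ⟨hω.2, hω.1⟩)
  have hclosed : closure S ∩ V ⊆ S := by
    rintro w ⟨hw, hwV⟩
    refine ⟨hwV, fun ε hε ↦ ?_⟩
    obtain ⟨w', hw', hd⟩ := Metric.mem_closure_iff.1 hw (ε / 2) (half_pos hε)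
    obtain ⟨t, ht⟩ := hw'.2 (ε / 2) (half_pos hε)
    refine ⟨t, ht.trans_le (measure_mono fun ω hω ↦ ⟨hω.1, ?_⟩)⟩
    refine Metric.ball_subset_ball' ?_ hω.2
    rw [dist_comm] at hd
    linarith
  -- If an unreachable `q` were near `w`, a nearest point to `q` in the compact set below would be
  -- reachable, and `hstep` would improve on it.
  have hopen : IsOpen S := by
    rw [Metric.isOpen_iff]
    intro w hw
    obtain ⟨δ, hδ, hball⟩ := Metric.isOpen_iff.1 hV w hw.1
    refine ⟨δ / 4, by positivity, fun q hq ↦ ?_⟩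
    by_contra hqS
    have hKV : Metric.closedBall w (δ / 2) ⊆ V :=
      (Metric.closedBall_subset_ball (by linarith)).trans hball
    have hK : IsCompact (closure S ∩ Metric.closedBall w (δ / 2)) :=
      (isCompact_closedBall w _).inter_left isClosed_closure
    obtain ⟨w₀, hw₀, hmin⟩ := hK.exists_isMinOn
      ⟨w, subset_closure hw, Metric.mem_closedBall_self (by positivity)⟩
      (f := fun x ↦ dist x q) (by fun_prop)
    have hw₀S : w₀ ∈ S := hclosed ⟨hw₀.1, hKV hw₀.2⟩
    obtain ⟨w₁, hw₁S, hlt⟩ := hstep w₀ hw₀S q (fun h ↦ hqS (h ▸ hw₀S))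
    have hle : dist w₀ q ≤ dist w q :=
      hmin ⟨subset_closure hw, Metric.mem_closedBall_self (by positivity)⟩
    rw [Metric.mem_ball] at hq
    have hw₁ : w₁ ∈ Metric.closedBall w (δ / 2) := by
      rw [Metric.mem_closedBall]
      have h1 := dist_triangle w₁ q w
      have h2 := dist_comm q w
      linarith
    have := hmin ⟨subset_closure hw₁S, hw₁⟩
    exact absurd (this : dist w₀ q ≤ dist w₁ q) (not_le.2 hlt)
  have hzS : z ∈ S := ⟨hz, fun ε hε ↦ ⟨0, by simp [hB.zero, hz, hε]⟩⟩
  exact (hVc.subset_of_closure_inter_subset hopen ⟨z, hz, hzS⟩ hclosed hw).2 ε hε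

/-- The complement of `U` may be as thin as a vertical slit, so the path is made to cross the slit:
it comes close to `w` on one side, then takes a short step to the other, and the intermediate value
theorem gives a hit. -/
theorem exists_measure_cross_pos (hB : IsContPlanarBrownian B P) {U V : Set ℂ} (hV : IsOpen V)
    (hVc : IsPreconnected V) {z : ℂ} (hz : z ∈ V) {w : ℂ} {δ : ℝ} (hδ : 0 < δ)
    (hball : Metric.ball w δ ⊆ V) (hU : ∀ w' ∈ Metric.ball w δ, w'.re = w.re → w' ∉ U) :
    ∃ t, t ≠ 0 ∧ 0 < P {ω | (∀ u ≤ t, z + B u ω ∈ V) ∧ ¬ ∀ u ≤ t, z + B u ω ∈ U} := by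
  have hsign : ∀ e : ℝ, (e = 1 ∨ e = -1) → ∃ ε > 0, ∀ t,
      0 < P {ω | (∀ u ≤ t, z + B u ω ∈ V) ∧
        z + B t ω ∈ Metric.ball w ε ∩ {x | 0 ≤ e * (x.re - w.re)}} →
      ∃ t, t ≠ 0 ∧ 0 < P {ω | (∀ u ≤ t, z + B u ω ∈ V) ∧ ¬ ∀ u ≤ t, z + B u ω ∈ U} := by
    intro e he
    have hee : e * e = 1 := by rcases he with rfl | rfl <;> norm_num
    have hen : ‖(e : ℂ)‖ = 1 := by rcases he with rfl | rfl <;> simp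
    obtain ⟨h, hh, ε, hε, hpos⟩ := hB.exists_step_pos (v := (e : ℂ))
      (norm_ne_zero_iff.1 (by rw [hen]; exact one_ne_zero)) (half_pos hδ)
    refine ⟨min ε (δ / 2), lt_min hε (half_pos hδ), fun t ht ↦ ⟨t + h, by positivity, ?_⟩⟩
    have hm : MeasurableSet {x : ℂ | 0 ≤ e * (x.re - w.re)} :=
      (isClosed_le continuous_const (by fun_prop)).measurableSet
    have hp := hB.measure_stay_step_pos hV (Metric.isOpen_ball.measurableSet.inter hm)
      Metric.isOpen_ball.measurableSet ht (hpos _ (hB.shift t))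
    refine hp.trans_le (measure_mono ?_)
    rintro ω ⟨⟨h1, h2, h2'⟩, h3, h4⟩
    rw [mem_ball_iff_norm] at h2 h4
    have hnear : ∀ u ≤ h, z + B (t + u) ω ∈ Metric.ball w δ := by
      intro u hu
      have h5 := h3 u hu
      rw [mem_closedBall_zero_iff] at h5
      rw [mem_ball_iff_norm]
      calc ‖z + B (t + u) ω - w‖ = ‖(z + B t ω - w) + (B (t + u) ω - B t ω)‖ := by ring_nf
        _ ≤ ‖z + B t ω - w‖ + ‖B (t + u) ω - B t ω‖ := norm_add_le _ _
        _ < δ := by linarith [min_le_right ε (δ / 2)]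
    refine ⟨fun u hu ↦ ?_, fun hall ↦ ?_⟩
    · rcases le_total u t with hut | hut
      · exact h1 u hut
      · obtain ⟨u, rfl⟩ := exists_add_of_le hut
        exact hball (hnear u (by simpa using hu))
    -- The signed offset from the line is below `ε` before the step, and the step changes it by less
    -- than `-ε`.
    · have hend : e * ((z + B (t + h) ω).re - w.re) ≤ 0 := by
        have a1 : e * ((z + B t ω).re - w.re) < ε := by
          have := Complex.abs_re_le_norm ((e : ℂ) * (z + B t ω - w))
          rw [norm_mul, hen, one_mul, Complex.re_ofReal_mul, Complex.sub_re] at this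
          linarith [le_abs_self (e * ((z + B t ω).re - w.re)), min_le_left ε (δ / 2)]
        have a2 : e * ((B (t + h) ω).re - (B t ω).re) + e * e < 1 - ε := by
          have := Complex.abs_re_le_norm ((e : ℂ) * (B (t + h) ω - B t ω - -(e : ℂ)))
          rw [norm_mul, hen, one_mul, Complex.re_ofReal_mul, Complex.sub_re, Complex.sub_re,
            Complex.neg_re, Complex.ofReal_re] at this
          rw [hen] at h4
          linarith [le_abs_self (e * ((B (t + h) ω).re - (B t ω).re - -e))]
        simp only [Complex.add_re] at a1 ⊢
        linarith
      have hc : ContinuousOn (fun u ↦ e * ((z + B (t + u) ω).re - w.re)) (Set.Icc 0 h) := by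
        have := hB.cont ω
        fun_prop
      obtain ⟨u, hu, hu0⟩ := intermediate_value_Icc' zero_le hc
        (show (0 : ℝ) ∈ Set.Icc _ _ from ⟨hend, by simpa using h2'⟩)
      have hre : (z + B (t + u) ω).re = w.re := by
        have : e ≠ 0 := by rintro rfl; simp at hee
        simpa [this, sub_eq_zero] using hu0
      exact hU _ (hnear u hu.2) hre (hall (t + u) (by simpa using hu.2))
  obtain ⟨ε₁, hε₁, h₁⟩ := hsign 1 (.inl rfl)
  obtain ⟨ε₂, hε₂, h₂⟩ := hsign (-1) (.inr rfl)
  obtain ⟨t, ht⟩ := hB.exists_measure_stay_pos hV hVc hz (hball (Metric.mem_ball_self hδ))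
    (lt_min hε₁ hε₂)
  by_contra hcon
  have z₁ := not_lt.1 fun h ↦ hcon (h₁ t h)
  have z₂ := not_lt.1 fun h ↦ hcon (h₂ t h)
  refine ht.ne' (measure_mono_null (fun ω hω ↦ ?_)
    (measure_union_null (nonpos_iff_eq_zero.1 z₁) (nonpos_iff_eq_zero.1 z₂)))
  rcases le_total w.re (z + B t ω).re with hle | hle
  · exact .inl ⟨hω.1, Metric.ball_subset_ball (min_le_left _ _) hω.2,
      show 0 ≤ 1 * ((z + B t ω).re - w.re) by linarith⟩
  · exact .inr ⟨hω.1, Metric.ball_subset_ball (min_le_right _ _) hω.2,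
      show 0 ≤ -1 * ((z + B t ω).re - w.re) by linarith⟩

end IsContPlanarBrownian

/-! ### Strict comparison of moments -/

theorem ENNReal.lintegral_rpow_eq_lintegral_measure_lt {Ω : Type*} [MeasurableSpace Ω]
    {P : Measure Ω} {X : Ω → ℝ≥0∞} (hX : Measurable X) {p : ℝ} (hp : 0 < p)
    (hfin : ∫⁻ ω, X ω ^ p ∂P ≠ ∞) :
    ∫⁻ ω, X ω ^ p ∂P = ENNReal.ofReal p *
      ∫⁻ t in Set.Ioi (0 : ℝ), P {ω | ENNReal.ofReal t < X ω} * ENNReal.ofReal (t ^ (p - 1)) := by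
  have hae : ∀ᵐ ω ∂P, X ω ≠ ∞ := by
    filter_upwards [ae_lt_top (hX.pow_const p) hfin] with ω hω h
    rw [h, ENNReal.top_rpow_of_pos hp] at hω
    exact lt_irrefl _ hω
  have h1 := lintegral_rpow_eq_lintegral_meas_lt_mul P (f := fun ω ↦ (X ω).toReal)
    (.of_forall fun ω ↦ ENNReal.toReal_nonneg) hX.ennreal_toReal.aemeasurable hp
  have h2 : ∫⁻ ω, X ω ^ p ∂P = ∫⁻ ω, ENNReal.ofReal ((X ω).toReal ^ p) ∂P := by
    refine lintegral_congr_ae ?_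
    filter_upwards [hae] with ω hω
    rw [← ENNReal.ofReal_rpow_of_nonneg ENNReal.toReal_nonneg hp.le, ENNReal.ofReal_toReal hω]
  rw [h2, h1]
  congr 1
  refine setLIntegral_congr_fun measurableSet_Ioi fun t ht ↦ ?_
  refine congrArg (· * ENNReal.ofReal (t ^ (p - 1))) (measure_congr ?_)
  filter_upwards [hae] with ω hω
  refine propext ?_
  change t < (X ω).toReal ↔ ENNReal.ofReal t < X ω
  rw [← ENNReal.ofReal_lt_iff_lt_toReal (le_of_lt ht) hω]

/-- By the layer cake formula only the tails matter. The tail of `Y` is right-continuous and that of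
`X` is antitone, so strictness at `t₀` spreads to an interval of positive length. -/
theorem ENNReal.lintegral_rpow_lt_of_measure_lt {Ω : Type*} [MeasurableSpace Ω] {P : Measure Ω}
    {X Y : Ω → ℝ≥0∞} (hX : Measurable X) (hY : Measurable Y) {p : ℝ} (hp : 0 < p)
    (hXf : ∫⁻ ω, X ω ^ p ∂P ≠ ∞) (hYf : ∫⁻ ω, Y ω ^ p ∂P ≠ ∞)
    (hle : ∀ t : ℝ≥0, t ≠ 0 → P {ω | t < X ω} ≤ P {ω | t < Y ω}) {t₀ : ℝ≥0}
    (hlt : P {ω | t₀ < X ω} < P {ω | t₀ < Y ω}) :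
    ∫⁻ ω, X ω ^ p ∂P < ∫⁻ ω, Y ω ^ p ∂P := by
  have hp' : ENNReal.ofReal p ≠ 0 := (ENNReal.ofReal_pos.2 hp).ne'
  have hanti : ∀ Z : Ω → ℝ≥0∞, Antitone fun t : ℝ ↦ P {ω | ENNReal.ofReal t < Z ω} :=
    fun Z s t hst ↦ measure_mono fun ω hω ↦ (ENNReal.ofReal_le_ofReal hst).trans_lt hω
  have hm : ∀ Z : Ω → ℝ≥0∞, Measurable fun t : ℝ ↦
      P {ω | ENNReal.ofReal t < Z ω} * ENNReal.ofReal (t ^ (p - 1)) := fun Z ↦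
    (hanti Z).measurable.mul (by fun_prop)
  obtain ⟨n, hn⟩ : ∃ n : ℕ, P {ω | t₀ < X ω} <
      P {ω | ((t₀ + ((n : ℝ≥0) + 1)⁻¹ : ℝ≥0) : ℝ≥0∞) < Y ω} := by
    have hU : {ω | t₀ < Y ω} = ⋃ n : ℕ, {ω | ((t₀ + ((n : ℝ≥0) + 1)⁻¹ : ℝ≥0) : ℝ≥0∞) < Y ω} := by
      ext ω
      simp only [Set.mem_ofPred_eq, Set.mem_iUnion]
      constructor
      · intro h
        obtain ⟨r, hr1, hr2⟩ := ENNReal.lt_iff_exists_nnreal_btwn.1 h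
        have hr1' : t₀ < r := by exact_mod_cast hr1
        obtain ⟨n, hn⟩ := exists_nat_one_div_lt (tsub_pos_of_lt hr1')
        refine ⟨n, lt_of_le_of_lt (ENNReal.coe_le_coe.2 ?_) hr2⟩
        rw [one_div, lt_tsub_iff_left] at hn
        exact hn.le
      · rintro ⟨n, hn⟩
        exact lt_of_le_of_lt (ENNReal.coe_le_coe.2 le_self_add) hn
    rw [hU] at hlt
    have hlim : Tendsto (fun n : ℕ ↦ P {ω | ((t₀ + ((n : ℝ≥0) + 1)⁻¹ : ℝ≥0) : ℝ≥0∞) < Y ω})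
        atTop (𝓝 (P (⋃ n : ℕ, {ω | ((t₀ + ((n : ℝ≥0) + 1)⁻¹ : ℝ≥0) : ℝ≥0∞) < Y ω}))) := by
      refine tendsto_measure_iUnion_atTop fun n m hnm ω hω ↦ ?_
      have hle : t₀ + ((m : ℝ≥0) + 1)⁻¹ ≤ t₀ + ((n : ℝ≥0) + 1)⁻¹ := by gcongr
      rw [Set.mem_ofPred_eq] at hω ⊢
      exact lt_of_le_of_lt (ENNReal.coe_le_coe.2 hle) hω
    exact (hlim.eventually (lt_mem_nhds hlt)).exists
  set t₁ : ℝ≥0 := t₀ + ((n : ℝ≥0) + 1)⁻¹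
  have ht01 : t₀ < t₁ := lt_add_of_pos_right _ (by positivity)
  rw [ENNReal.lintegral_rpow_eq_lintegral_measure_lt hX hp hXf,
    ENNReal.lintegral_rpow_eq_lintegral_measure_lt hY hp hYf,
    ENNReal.mul_lt_mul_iff_right hp' ENNReal.ofReal_ne_top]
  refine lintegral_strict_mono_of_ae_le_of_ae_lt_on (hm Y).aemeasurable ?_ ?_
    (s := Set.Ioo (t₀ : ℝ) t₁) ?_ ?_
  · intro h
    rw [ENNReal.lintegral_rpow_eq_lintegral_measure_lt hX hp hXf, h, ENNReal.mul_top hp'] at hXf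
    exact hXf rfl
  · filter_upwards [ae_restrict_mem measurableSet_Ioi] with t ht
    gcongr ?_ * _
    exact hle t.toNNReal (Real.toNNReal_pos.2 ht).ne'
  · have hsub : Set.Ioo (t₀ : ℝ) t₁ ⊆ Set.Ioi 0 := fun t ht ↦
      lt_of_le_of_lt t₀.coe_nonneg ht.1
    rw [Measure.restrict_apply measurableSet_Ioo, Set.inter_eq_left.2 hsub, Real.volume_Ioo]
    exact (ENNReal.ofReal_pos.2 (sub_pos.2 (by exact_mod_cast ht01))).ne'
  · refine .of_forall fun t ht ↦ ?_
    have ht0 : 0 < t := lt_of_le_of_lt t₀.coe_nonneg ht.1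
    have h0 : ENNReal.ofReal (t ^ (p - 1)) ≠ 0 := (ENNReal.ofReal_pos.2 (by positivity)).ne'
    rw [ENNReal.mul_lt_mul_iff_left h0 ENNReal.ofReal_ne_top]
    have a1 := hanti X ht.1.le
    have a2 := hanti Y ht.2.le
    simp only [ENNReal.ofReal_coe_nnreal] at a1 a2
    exact (a1.trans_lt hn).trans_le a2

/-! ### Moments of exit times at mirror points and translates -/

namespace IsContPlanarBrownian

variable {Ω : Type*} [MeasurableSpace Ω] {P : Measure Ω} {B : ℝ≥0 → Ω → ℂ}

theorem measure_lt_exitTime (hB : IsContPlanarBrownian B P) {U : Set ℂ} (hU : IsOpen U) (z : ℂ)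
    (t : ℝ≥0) : P {ω | t < exitTime U (fun t ω ↦ z + B t ω) ω} =
      P {ω | ∀ u ≤ t, z + B u ω ∈ U} := by
  congr 1
  ext ω
  exact lt_exitTime_iff hU (hB.continuous_add z ω) t

theorem exitMoment_lt_horizRefl (hB : IsContPlanarBrownian B P) {p : ℝ} (hp : 0 < p) {s : ℝ}
    {U : Set ℂ} (hU : IsOpen U) (hUσ : ∀ z ∈ U, s ≤ z.im → horizRefl s z ∈ U) {z : ℂ}
    (hz : s ≤ z.im) (hfin : exitMoment B P U p z < ∞)
    (hfin' : exitMoment B P U p (horizRefl s z) < ∞) {t : ℝ≥0} (ht : t ≠ 0)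
    (hpos : 0 < P {ω | (∀ u ≤ t, z + B u ω ∈ upperRefl s U) ∧ ¬ ∀ u ≤ t, z + B u ω ∈ U}) :
    exitMoment B P U p z < exitMoment B P U p (horizRefl s z) := by
  refine ENNReal.lintegral_rpow_lt_of_measure_lt (hB.measurable_exitTime hU z)
    (hB.measurable_exitTime hU _) hp hfin.ne hfin'.ne (fun t ht ↦ ?_) (t₀ := t) ?_
  · rw [hB.measure_lt_exitTime hU, hB.measure_lt_exitTime hU]
    exact hB.measure_stay_le_horizRefl hU hUσ ht hz
  · rw [hB.measure_lt_exitTime hU, hB.measure_lt_exitTime hU]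
    by_contra hcon
    exact hpos.ne' (hB.measure_stay_upperRefl_diff_eq_zero hU hUσ ht hz (not_lt.1 hcon))

/-- On the closed interval up to its exit time the path lies in `closure U`, so the translated path
is still in `U` at that time. Finite moments make the exit time almost surely finite. -/
theorem exitMoment_lt_add (hB : IsContPlanarBrownian B P) {p : ℝ} (hp : 0 < p)
    {U : Set ℂ} (hU : IsOpen U) {v : ℂ} (hv : ∀ z ∈ closure U, z + v ∈ U) {z : ℂ} (hz : z ∈ U)
    (hfin : exitMoment B P U p z < ∞) :
    exitMoment B P U p z < exitMoment B P U p (z + v) := by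
  have hP := hB.isProbabilityMeasure
  refine lintegral_strict_mono hP.ne_zero
    ((hB.measurable_exitTime hU _).pow_const p).aemeasurable hfin.ne ?_
  filter_upwards [ae_lt_top ((hB.measurable_exitTime hU z).pow_const p) hfin.ne] with ω hω
  refine ENNReal.rpow_lt_rpow ?_ hp
  generalize hτ : exitTime U (fun t ω ↦ z + B t ω) ω = τ at hω ⊢
  induction τ with
  | top => simp [ENNReal.top_rpow_of_pos hp] at hω
  | coe t =>
    rw [lt_exitTime_iff hU (hB.continuous_add _ ω)]
    have hlt : ∀ u < t, z + B u ω ∈ U := fun u hu ↦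
      (lt_exitTime_iff hU (hB.continuous_add z ω) u).1
        (by rw [hτ]; exact_mod_cast hu) u le_rfl
    intro u hu
    rw [add_right_comm]
    refine hv _ ?_
    rcases hu.eq_or_lt with rfl | hu
    · rcases eq_or_ne u 0 with rfl | h0
      · simpa [hB.zero] using subset_closure hz
      · have hmem : u ∈ closure (Set.Iio u) := by
          rw [closure_Iio' ⟨0, pos_iff_ne_zero.2 h0⟩]
          exact Set.mem_Iic.2 le_rfl
        exact map_mem_closure (f := fun t ↦ z + B t ω) (hB.continuous_add z ω) hmem hlt
    · exact subset_closure (hlt u hu)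

end IsContPlanarBrownian

/-! ### Domains with convex symmetric vertical slices -/

/-- The set is the mirror image of the part of `U` below height `s`. As `s > 0`, that part contains
the projection of `U` to the axis, to which each of its points is joined vertically. -/
theorem isPreconnected_upperRefl {s : ℝ} (hs : 0 < s) {U : Set ℂ} (hU : IsPreconnected U)
    (hconv : ∀ z ∈ U, ∀ y : ℝ, |y| ≤ |z.im| → (⟨z.re, y⟩ : ℂ) ∈ U) :
    IsPreconnected (upperRefl s U) := by
  have hlow : IsPreconnected (U ∩ {z | z.im < s}) := by
    have haxis : IsPreconnected ((fun z : ℂ ↦ (z.re : ℂ)) '' U) :=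
      hU.image _ (by fun_prop)
    have hsub : (fun z : ℂ ↦ (z.re : ℂ)) '' U ⊆ U ∩ {z | z.im < s} := by
      rintro _ ⟨z, hz, rfl⟩
      exact ⟨hconv z hz 0 (by simp), by simpa using hs⟩
    rcases (U ∩ {z | z.im < s}).eq_empty_or_nonempty with h | ⟨z₀, hz₀⟩
    · rw [h]
      exact isPreconnected_empty
    refine isPreconnected_of_forall (z₀.re : ℂ) fun z hz ↦
      ⟨(fun z : ℂ ↦ (z.re : ℂ)) '' U ∪ (fun y : ℝ ↦ (⟨z.re, y⟩ : ℂ)) '' Set.uIcc 0 z.im,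
        Set.union_subset hsub ?_, .inl ⟨z₀, hz₀.1, rfl⟩, .inr ⟨z.im, by simp, rfl⟩, ?_⟩
    · rintro _ ⟨y, hy, rfl⟩
      have h1 : |y| ≤ |z.im| := by simpa using Set.abs_sub_left_of_mem_uIcc hy
      refine ⟨hconv z hz.1 y h1, ?_⟩
      have h2 : z.im < s := hz.2
      change y < s
      exact hy.2.trans_lt (max_lt hs h2)
    · have hc : Continuous fun y : ℝ ↦ (⟨z.re, y⟩ : ℂ) :=
        Complex.equivRealProdCLM.symm.continuous.comp (continuous_const.prodMk continuous_id)
      exact haxis.union (z.re : ℂ) ⟨z, hz.1, rfl⟩ ⟨0, by simp, rfl⟩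
        (isPreconnected_uIcc.image _ hc.continuousOn)
  have himg : upperRefl s U = horizRefl s '' (U ∩ {z | z.im < s}) := by
    ext z
    constructor
    · rintro ⟨h1, h2⟩
      refine ⟨horizRefl s z, ⟨h2, ?_⟩, horizRefl_horizRefl s z⟩
      change 2 * s - z.im < s
      linarith
    · rintro ⟨w, ⟨h1, h2⟩, rfl⟩
      have h2' : w.im < s := h2
      exact ⟨by simp only [horizRefl_im]; linarith, by simpa using h1⟩
  rw [himg]
  exact hlow.image _ (continuous_horizRefl s).continuousOn

theorem eq_vertical_strip_of_isMaxOn {Ω : Type*} [MeasurableSpace Ω] {P : Measure Ω}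
    {B : ℝ≥0 → Ω → ℂ} (hB : IsContPlanarBrownian B P) {p : ℝ} (hp : 0 < p) {U : Set ℂ}
    (hUo : IsOpen U) (hUc : IsConnected U)
    (hconv : ∀ z ∈ U, ∀ y : ℝ, |y| ≤ |z.im| → (⟨z.re, y⟩ : ℂ) ∈ U)
    (hfin : ∀ a ∈ U, exitMoment B P U p a < ∞) {a : ℂ} (haU : a ∈ U)
    (ha : IsMaxOn (exitMoment B P U p) U a) (him : 0 < a.im) :
    ∃ c d : ℝ, c < d ∧ U = {z | c < z.re ∧ z.re < d} := by
  have hfull : ∀ z ∈ U, ∀ y : ℝ, (⟨z.re, y⟩ : ℂ) ∈ U := by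
    by_contra! hcon
    obtain ⟨z, hz, y, hy⟩ := hcon
    set x := z.re
    have hc : Continuous fun y : ℝ ↦ (⟨x, y⟩ : ℂ) :=
      Complex.equivRealProdCLM.symm.continuous.comp (continuous_const.prodMk continuous_id)
    set T : Set ℝ := {y | 0 ≤ y ∧ (⟨x, y⟩ : ℂ) ∉ U}
    have hTc : IsClosed T :=
      (isClosed_le continuous_const continuous_id).inter (hUo.isClosed_compl.preimage hc)
    have hTb : BddBelow T := ⟨0, fun y hy ↦ hy.1⟩
    have hTne : T.Nonempty := ⟨|y|, abs_nonneg y, fun h ↦ hy (hconv _ h y (by simp))⟩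
    set h := sInf T
    have hhT : h ∈ T := hTc.csInf_mem hTne hTb
    have hbelow : ∀ y, |y| < h → (⟨x, y⟩ : ℂ) ∈ U := by
      intro y hy
      have h1 : (⟨x, |y|⟩ : ℂ) ∈ U := by
        by_contra h1
        exact absurd (csInf_le hTb (show |y| ∈ T from ⟨abs_nonneg y, h1⟩)) (not_le.2 hy)
      exact hconv _ h1 y (by simp)
    have habove : ∀ y, h ≤ y → (⟨x, y⟩ : ℂ) ∉ U := fun y hy hyU ↦
      hhT.2 (hconv _ hyU h (by simpa [abs_of_nonneg hhT.1] using hy.trans (le_abs_self y)))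
    have hpos : 0 < h := by
      refine lt_of_le_of_ne hhT.1 fun h0 ↦ hhT.2 ?_
      rw [← h0]
      exact hconv z hz 0 (by simp)
    -- The line lies below `a` and below the top `h` of the slice. The point at height `h + s`
    -- mirrors to height `s - h`, inside the slice, while points of its vertical line within
    -- distance `s` are above the slice.
    set s := min a.im h / 2 with hs
    have hs0 : 0 < s := half_pos (lt_min him hpos)
    have hsa : s < a.im := by linarith [min_le_left a.im h]
    have hsh : s < h := by linarith [min_le_right a.im h]
    have hUσ : ∀ z ∈ U, s ≤ z.im → horizRefl s z ∈ U := fun z hz hsz ↦ by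
      refine hconv z hz _ ?_
      rw [abs_of_pos (hs0.trans_le hsz), abs_le]
      constructor <;> linarith
    have haσ := hUσ a haU hsa.le
    have hw : (⟨x, h + s⟩ : ℂ) ∈ upperRefl s U := by
      refine ⟨by simpa using hpos, hbelow _ ?_⟩
      rw [abs_lt]
      constructor <;> simp <;> linarith
    obtain ⟨δ, hδ, hball⟩ := Metric.isOpen_iff.1 (isOpen_upperRefl s hUo) _ hw
    obtain ⟨t, ht, hcross⟩ := hB.exists_measure_cross_pos (U := U) (isOpen_upperRefl s hUo)
      (isPreconnected_upperRefl hs0 hUc.isPreconnected hconv) (z := a) ⟨hsa, haσ⟩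
      (w := ⟨x, h + s⟩) (δ := min δ s) (lt_min hδ hs0)
      ((Metric.ball_subset_ball (min_le_left _ _)).trans hball) (by
        intro w' hw' hre hwU
        refine habove w'.im ?_ (by
          have : (⟨x, w'.im⟩ : ℂ) = w' := Complex.ext hre.symm rfl
          rwa [this])
        rw [mem_ball_iff_norm] at hw'
        have h1 := (Complex.abs_im_le_norm (w' - ⟨x, h + s⟩)).trans_lt
          (hw'.trans_le (min_le_right _ _))
        rw [Complex.sub_im, abs_lt] at h1
        simp only at h1
        linarith [h1.1])
    exact absurd (ha haσ) (not_le.2 (hB.exitMoment_lt_horizRefl hp hUo hUσ hsa.le (hfin a haU)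
      (hfin _ haσ) ht hcross))
  set I : Set ℝ := Complex.re '' U
  have hmem : ∀ z : ℂ, z ∈ U ↔ z.re ∈ I := by
    refine fun z ↦ ⟨fun h ↦ ⟨z, h, rfl⟩, ?_⟩
    rintro ⟨w, hw, hwz⟩
    have := hfull w hw z.im
    rwa [hwz] at this
  have hIo : IsOpen I := Complex.isOpenMap_re U hUo
  have hIc : IsPreconnected I := hUc.isPreconnected.image _ Complex.continuous_re.continuousOn
  have hIord := hIc.ordConnected
  have hIne : I.Nonempty := hUc.nonempty.image _
  have hclos : ∀ z ∈ closure U, z.re ∈ closure I := fun z hz ↦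
    map_mem_closure Complex.continuous_re hz fun w hw ↦ ⟨w, hw, rfl⟩
  have hno : ∀ e : ℝ, ¬ ∀ x ∈ closure I, x + e ∈ I := by
    intro e he
    have hv : ∀ z ∈ closure U, z + (e : ℂ) ∈ U := fun z hz ↦ by
      rw [hmem]
      simpa using he _ (hclos z hz)
    exact absurd (ha (hv a (subset_closure haU)))
      (not_le.2 (hB.exitMoment_lt_add hp hUo hv haU (hfin a haU)))
  have hab : BddAbove I := by
    by_contra hcon
    refine hno 1 fun x hx ↦ ?_
    obtain ⟨y, hy, hxy⟩ := Metric.mem_closure_iff.1 hx 1 one_pos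
    obtain ⟨y', hy', hlt⟩ := not_bddAbove_iff.1 hcon (x + 1)
    rw [Real.dist_eq, abs_lt] at hxy
    exact hIord.out hy hy' ⟨by linarith, hlt.le⟩
  have hbb : BddBelow I := by
    by_contra hcon
    refine hno (-1) fun x hx ↦ ?_
    obtain ⟨y, hy, hxy⟩ := Metric.mem_closure_iff.1 hx 1 one_pos
    obtain ⟨y', hy', hlt⟩ := not_bddBelow_iff.1 hcon (x + -1)
    rw [Real.dist_eq, abs_lt] at hxy
    exact hIord.out hy' hy ⟨hlt.le, by linarith⟩
  have hIeq : I = Set.Ioo (sInf I) (sSup I) := by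
    refine Set.Subset.antisymm (fun x hx ↦ ?_) (IsConnected.Ioo_csInf_csSup_subset ⟨hIne, hIc⟩ hbb hab)
    obtain ⟨l, u, hx', hlu⟩ := mem_nhds_iff_exists_Ioo_subset.1 (hIo.mem_nhds hx)
    obtain ⟨y₁, h1, h2⟩ := exists_between hx'.1
    obtain ⟨y₂, h3, h4⟩ := exists_between hx'.2
    exact ⟨(csInf_le hbb (hlu ⟨h1, h2.trans hx'.2⟩)).trans_lt h2,
      h3.trans_le (le_csSup hab (hlu ⟨hx'.1.trans h3, h4⟩))⟩
  refine ⟨sInf I, sSup I, ?_, ?_⟩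
  · obtain ⟨x, hx⟩ := hIne
    rw [hIeq] at hx
    exact hx.1.trans hx.2
  · ext z
    rw [hmem]
    conv_lhs => rw [hIeq]
    exact Iff.rfl

/-! ### The axis in general position -/

theorem reflection_add_mul {Δ : AffineSubspace ℝ ℂ} [Nonempty Δ] {d q : ℂ} (hq : q ∈ Δ)
    (hd : d ∈ Δ.direction) (hspan : ∀ w ∈ Δ.direction, ∃ c : ℝ, c • d = w) (z : ℂ) :
    EuclideanGeometry.reflection Δ (q + d * z) = q + d * (starRingEnd ℂ z) := by
  have h1 : q + d * z.re ∈ Δ := by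
    have := Δ.vadd_mem_of_mem_direction (Δ.direction.smul_mem z.re hd) hq
    rwa [vadd_eq_add, Complex.real_smul, add_comm, mul_comm] at this
  have h2 : d * (z.im * Complex.I) ∈ Δ.directionᗮ := by
    rw [Submodule.mem_orthogonal]
    intro w hw
    obtain ⟨c, rfl⟩ := hspan w hw
    rw [Complex.inner]
    simp
    ring
  have h3 := EuclideanGeometry.reflection_orthogonal_vadd h1 h2
  rw [vadd_eq_add, vadd_eq_add] at h3
  have h4 : q + d * z = d * (z.im * Complex.I) + (q + d * z.re) := by
    linear_combination -d * Complex.re_add_im z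
  have h5 : starRingEnd ℂ z = z.re - z.im * Complex.I := by
    refine Complex.ext ?_ ?_ <;> simp
  rw [h4, h3, h5]
  ring

/-- In the coordinate `d⁻¹ * (w - q)` the axis is the real line and the reflection is conjugation.
Rotated Brownian motion is again Brownian, so the moments carry over. -/
theorem im_nonpos_of_isPthCenter {Ω : Type*} [MeasurableSpace Ω] {P : Measure Ω}
    {B : ℝ≥0 → Ω → ℂ} (hB : IsContPlanarBrownian B P) {p : ℝ} (hp : 0 < p) {U : Set ℂ}
    (hUo : IsOpen U) (hUc : IsConnected U) (hfin : ∀ a ∈ U, exitMoment B P U p a < ∞)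
    {Δ : AffineSubspace ℝ ℂ} [Nonempty Δ] (hconv : IsDeltaConvex Δ U)
    (hstrip : ¬ IsPerpendicularStrip Δ U) {a : ℂ} (ha : IsPthCenter B P U p a) {d q : ℂ}
    (hq : q ∈ Δ) (hd : d ∈ Δ.direction) (hd1 : ‖d‖ = 1)
    (hspan : ∀ w ∈ Δ.direction, ∃ c : ℝ, c • d = w) : (d⁻¹ * (a - q)).im ≤ 0 := by
  by_contra! him
  have hd0 : d ≠ 0 := norm_ne_zero_iff.1 (by rw [hd1]; exact one_ne_zero)
  set U' : Set ℂ := {z | q + d * z ∈ U} with hU'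
  have himg : U' = (fun w ↦ d⁻¹ * (w - q)) '' U := by
    ext z
    constructor
    · intro hz
      exact ⟨q + d * z, hz, by simp [hd0]⟩
    · rintro ⟨w, hw, rfl⟩
      simpa [hU', hd0] using hw
  have hmom : ∀ z, exitMoment (fun t ω ↦ d⁻¹ * B t ω) P U' p z =
      exitMoment B P U p (q + d * z) := by
    intro z
    have hiff : ∀ t ω, z + d⁻¹ * B t ω ∉ U' ↔ q + d * z + B t ω ∉ U := by
      intro t ω
      rw [hU', Set.mem_ofPred_eq, mul_add, mul_inv_cancel_left₀ hd0, add_assoc]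
    simp only [exitMoment, exitTime, hiff]
  have hconv' : ∀ z ∈ U', ∀ y : ℝ, |y| ≤ |z.im| → (⟨z.re, y⟩ : ℂ) ∈ U' := by
    intro z hz y hy
    rcases eq_or_ne z.im 0 with h0 | h0
    · have hy0 : y = 0 := by simpa [h0] using hy
      have : (⟨z.re, y⟩ : ℂ) = z := Complex.ext rfl (by simp [hy0, h0])
      rwa [this]
    · have hle : |y / z.im| ≤ 1 := by
        rw [abs_div]
        exact div_le_one_of_le₀ hy (abs_nonneg _)
      rw [abs_le] at hle
      -- The weight `t` solves `(2 t - 1) * z.im = y`.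
      have := hconv _ hz ((1 + y / z.im) / 2) ⟨by linarith [hle.1], by linarith [hle.2]⟩
      rw [reflection_add_mul hq hd hspan] at this
      have he : (⟨z.re, y⟩ : ℂ) = (((1 + y / z.im) / 2 : ℝ) : ℂ) * z +
          (1 - (((1 + y / z.im) / 2 : ℝ) : ℂ)) * (starRingEnd ℂ z) := by
        refine Complex.ext ?_ ?_
        · rw [Complex.add_re, ← Complex.ofReal_one, ← Complex.ofReal_sub, Complex.re_ofReal_mul,
            Complex.re_ofReal_mul, Complex.conj_re]
          ring
        · rw [Complex.add_im, ← Complex.ofReal_one, ← Complex.ofReal_sub, Complex.im_ofReal_mul,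
            Complex.im_ofReal_mul, Complex.conj_im]
          field_simp
          ring
      rw [hU', Set.mem_ofPred_eq, he]
      convert this using 1
      ring
  have haq : q + d * (d⁻¹ * (a - q)) = a := by
    rw [mul_inv_cancel_left₀ hd0]
    ring
  obtain ⟨c, e, hce, hstrip'⟩ := eq_vertical_strip_of_isMaxOn
    (hB.const_mul (u := d⁻¹) (by rw [norm_inv, hd1, inv_one])) hp (U := U')
    (hUo.preimage (by fun_prop)) (himg ▸ hUc.image _ (by fun_prop)) hconv'
    (fun z hz ↦ by rw [hmom]; exact hfin _ hz) (a := d⁻¹ * (a - q))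
    (by rw [hU', Set.mem_ofPred_eq, haq]; exact ha.1)
    (fun z hz ↦ by
      change exitMoment _ P U' p z ≤ exitMoment _ P U' p _
      rw [hmom, hmom, haq]
      exact ha.2 hz) him
  refine hstrip ⟨d, hd, hd0, c + inner ℝ d q, e + inner ℝ d q, by linarith, ?_⟩
  have hinner : ∀ w, inner ℝ d w = (d⁻¹ * (w - q)).re + inner ℝ d q := by
    intro w
    have hinv : d⁻¹ = starRingEnd ℂ d := by
      rw [Complex.inv_def, Complex.normSq_eq_norm_sq, hd1]
      simp
    rw [hinv, Complex.inner, Complex.inner, mul_comm w, mul_comm q, mul_sub, Complex.sub_re]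
    ring
  ext w
  have hw : w ∈ U ↔ d⁻¹ * (w - q) ∈ U' := by
    rw [hU', Set.mem_ofPred_eq, mul_inv_cancel_left₀ hd0, add_sub_cancel]
  rw [hw, hstrip', Set.mem_ofPred_eq, Set.mem_ofPred_eq, hinner w]
  constructor <;> rintro ⟨h1, h2⟩ <;> constructor <;> linarith

theorem mainTheorem3 {Ω : Type*} [MeasurableSpace Ω] (P : Measure Ω) (B : ℝ≥0 → Ω → ℂ)
    (hB : IsPlanarBrownian B P)
    (p : ℝ) (hp : 0 < p)
    (U : Set ℂ) (hUo : IsOpen U) (hUc : IsConnected U)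
    (hfin : ∀ a ∈ U, exitMoment B P U p a < ∞)
    (Δ : AffineSubspace ℝ ℂ) [Nonempty Δ]
    (hsymm : IsSymmetryAxis Δ U) (hconv : IsDeltaConvex Δ U)
    (hstrip : ¬ IsPerpendicularStrip Δ U)
    (a : ℂ) (ha : IsPthCenter B P U p a) :
    a ∈ Δ := by
  obtain ⟨B', hm, hc, h0, hae⟩ := hB.exists_ae_eq
  have hB' := (hB.congr_ae hc hae).isContPlanarBrownian hm hc h0
  have hmom : exitMoment B P U p = exitMoment B' P U p := by
    ext z
    refine lintegral_congr_ae ?_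
    filter_upwards [hae] with ω hω
    simp only [exitTime, hω]
  rw [hmom] at hfin
  rw [IsPthCenter, hmom] at ha
  obtain ⟨⟨q, hq⟩⟩ := ‹Nonempty Δ›
  obtain ⟨⟨d₀, hd₀⟩, hne, hspan₀⟩ := finrank_eq_one_iff'.1 hsymm.1
  have hd₀0 : d₀ ≠ 0 := fun h ↦ hne (Subtype.ext h)
  have hn : ‖d₀‖ ≠ 0 := norm_ne_zero_iff.2 hd₀0
  set d : ℂ := ‖d₀‖⁻¹ • d₀ with hd_def
  have hd : d ∈ Δ.direction := Δ.direction.smul_mem _ hd₀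
  have hd1 : ‖d‖ = 1 := by rw [hd_def, norm_smul, norm_inv, norm_norm, inv_mul_cancel₀ hn]
  have hd0 : d ≠ 0 := norm_ne_zero_iff.1 (by rw [hd1]; exact one_ne_zero)
  have hspan : ∀ w ∈ Δ.direction, ∃ c : ℝ, c • d = w := by
    intro w hw
    obtain ⟨c, hc⟩ := hspan₀ ⟨w, hw⟩
    refine ⟨c * ‖d₀‖, ?_⟩
    rw [hd_def, smul_smul, mul_assoc, mul_inv_cancel₀ hn, mul_one]
    exact congrArg Subtype.val hc
  have h1 := im_nonpos_of_isPthCenter hB' hp hUo hUc hfin hconv hstrip ha hq hd hd1 hspan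
  -- The opposite direction `-d` exchanges the two sides of the axis.
  have h2 := im_nonpos_of_isPthCenter hB' hp hUo hUc hfin hconv hstrip ha hq
    (Δ.direction.neg_mem hd) (by rwa [norm_neg])
    (fun w hw ↦ (hspan w hw).imp' Neg.neg fun c hc ↦ by rw [neg_smul_neg, hc])
  rw [inv_neg, neg_mul, Complex.neg_im, neg_nonpos] at h2
  have him : (d⁻¹ * (a - q)).im = 0 := le_antisymm h1 h2
  have haq : a = ((d⁻¹ * (a - q)).re • d : ℂ) +ᵥ q := by
    have hre : (((d⁻¹ * (a - q)).re : ℝ) : ℂ) = d⁻¹ * (a - q) := Complex.ext rfl (by simp [him])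
    rw [vadd_eq_add, Complex.real_smul, hre]
    field_simp
    ring
  rw [haq]
  exact Δ.vadd_mem_of_mem_direction (Δ.direction.smul_mem _ hd) hq
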